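/- An instance is a finite sequence $I=(X_1,\dots,X_n)$ of independent non-negative random variables with finite expectation, and $\mathrm{OPT}(I)=\mathbb E[M]$ with $M=\max_i X_i$. For $\tau\ge 0$ let $\mathrm{TAL}(I,\tau)$ be the expected value of the algorithm that accepts the first $X_i\ge\tau$ (and gets $0$ if there is none), and for $\alpha\in(0,1)$ let $\mathrm{TAL}_\alpha(I,\tau)$ be the expected value of the prediction-augmented threshold algorithm, which accepts the first $X_i\ge\max\{\tau,\alpha M\}$ (and gets $0$ if there is none). Let $\eta(I)=\sup\{\tau\ge 0:\mathrm{TAL}(I,\tau)\ge\tau\}$ be the SC-threshold of $I$, and let $I^{(k)}=(X_1,\dots,X_k)$. Fix $\alpha\in(0,1)$. (a) For every instance $I$ there is a base threshold $\tau\ge 0$ with $$\mathrm{TAL}_\alpha(I,\tau)\ \ge\ \frac{1}{2-\alpha}\,\mathrm{OPT}(I).$$ (b) Let $I$ be a sorted scaled Bernoulli instance, that is, there are values $0\le v_1\le\dots\le v_n$ such that each $X_i$ is supported on $\{0,v_i\}$. Put $s_\alpha=\max\{k\in\{1,\dots,n\}:\eta(I^{(k)})\ge\alpha v_k\}$ and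 $\tau^*_\alpha=\eta(I^{(s_\alpha)})$, with $\tau^*_\alpha=0$ if no such $k$ exists. Then $\tau^*_\alpha\ge 0$ and $$\mathrm{TAL}_\alpha(I,\tau^*_\alpha)\ \ge\ \frac{1}{2-\alpha}\,\mathrm{OPT}(I).$$ -/

import Mathlib

open MeasureTheory ProbabilityTheory

noncomputable section

namespace Prophet

/-- The maximum `m(R)` of a realization `R = (v₁, …, vₙ)` (by convention `0` when `n = 0`). -/
def realizedMax {n : ℕ} (R : Fin n → ℝ) : ℝ := ⨆ i, R i

open Classical in
/-- Reward of the threshold algorithm on a realization: the value at the first index `i` with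
`τ ≤ R i`, and `0` if there is no such index. -/
def thrReward {n : ℕ} (R : Fin n → ℝ) (τ : ℝ) : ℝ :=
  if h : ∃ i, τ ≤ R i then R (Fin.find (fun i => τ ≤ R i) h) else 0

/-- Reward of the prediction-augmented threshold algorithm on a realization: the effective
threshold is `max {τ, α · m(R)}`. -/
def augReward {n : ℕ} (α : ℝ) (R : Fin n → ℝ) (τ : ℝ) : ℝ :=
  thrReward R (max τ (α * realizedMax R))

variable {Ω : Type*} [MeasurableSpace Ω] (μ : Measure Ω)

/-- The prophet's value `E[maxᵢ Xᵢ]`. -/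
def OPT {n : ℕ} (X : Fin n → Ω → ℝ) : ℝ := ∫ ω, realizedMax (fun i => X i ω) ∂μ

/-- Expected value of the threshold algorithm with threshold `τ`. -/
def TAL {n : ℕ} (X : Fin n → Ω → ℝ) (τ : ℝ) : ℝ := ∫ ω, thrReward (fun i => X i ω) τ ∂μ

/-- Expected value of the prediction-augmented threshold algorithm with base threshold `τ`. -/
def augTAL {n : ℕ} (α : ℝ) (X : Fin n → Ω → ℝ) (τ : ℝ) : ℝ :=
  ∫ ω, augReward α (fun i => X i ω) τ ∂μ

/-- The SC-threshold `η(I) = sup {τ ≥ 0 | TAL(I, τ) ≥ τ}`. For non-negative integrable variables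
the set contains `0` and is bounded above by `OPT(I)`. -/
def scThreshold {n : ℕ} (X : Fin n → Ω → ℝ) : ℝ := sSup {τ : ℝ | 0 ≤ τ ∧ τ ≤ TAL μ X τ}

/-- The prefix of an instance consisting of the variables with (zero-based) indices `0, …, k`. -/
def prefixThrough {n : ℕ} (X : Fin n → Ω → ℝ) (k : Fin n) : Fin (k.val + 1) → Ω → ℝ :=
  fun i => X (Fin.castLE k.isLt i)

/-- `X` is a sorted scaled Bernoulli instance with values `0 ≤ v₁ ≤ ⋯ ≤ vₙ`: the variable `X i`
is supported on `{0, v i}`. -/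
structure IsSortedScaledBernoulli {n : ℕ} (X : Fin n → Ω → ℝ) (v : Fin n → ℝ) : Prop where
  nonneg : ∀ i, 0 ≤ v i
  sorted : Monotone v
  supported : ∀ i, ∀ᵐ ω ∂μ, X i ω = 0 ∨ X i ω = v i

open Classical in
/-- The indices `k` for which the prefix ending at `k` satisfies `η(prefix) ≥ α · v k`. -/
def goodPrefixes {n : ℕ} (α : ℝ) (X : Fin n → Ω → ℝ) (v : Fin n → ℝ) : Finset (Fin n) :=
  Finset.univ.filter (fun k => α * v k ≤ scThreshold μ (prefixThrough X k))

open Classical in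
/-- The base threshold `τ*_α`: the SC-threshold of the largest prefix with `η(prefix) ≥ α · v k`.
If no non-empty prefix qualifies, the prefix is the empty one, whose SC-threshold is `0`. -/
def tauStar {n : ℕ} (α : ℝ) (X : Fin n → Ω → ℝ) (v : Fin n → ℝ) : ℝ :=
  if h : (goodPrefixes μ α X v).Nonempty then
    scThreshold μ (prefixThrough X ((goodPrefixes μ α X v).max' h))
  else 0

end Prophet

end

noncomputable section

namespace Prophet

/-! Let `F x = P(M < x)` (`cdfLT`) and `J v = ∫ 1 / F` over `[α v, v]`. Write the base threshold as
`α * s`, so that the effective threshold is `α * max s M`: constant while `M ≤ s`, proportional to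
`M` afterwards.

By independence, when the maximum is at least `y ≥ x`, the values avoid `[a, x)` with conditional
probability at least `F a / F x` (`cdfLT_div_mul_le`); any threshold in `[a, M]` then earns at least
`x`. Integrating over `x`, a maximum near `v > s` earns at least `α v + F(α v) J(v)`. Hence `(2 - α)
* reward - M` accrues against `dF(v)` at rate at least `slope α F v`.

The level `s` is a balance point: `F(v) J(v) ≤ v` for every `v > s`, while at `s` either `F(α s) =
0` or `s ≤ P(M ≤ s) J(s)`. The condition at `s` makes the event `M ≤ s` contribute at least `α s P(M
≤ s)`. What remains is an inequality about monotone `F`: the accumulated `potential` is nonnegative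
up to the mesh (`potential_lower_bound`). Integration by parts bounds it below by `potentialBound`,
and Cauchy–Schwarz bounds that below by `(v / J - F) * (-slope)`. Where the slope is negative this
is nonnegative by balance; where it is nonnegative the potential can only grow. `OPT_le_augTAL`
combines these facts.

For general instances `s` is the supremum of the levels violating the upper balance condition. For
sorted Bernoulli instances `s = τ* / α`: the reward bound applied to prefixes gives balance above
`s`, and for such instances that bound is sharp (`TAL_le`), which gives balance at `s`. -/

/-- The integral of `1 / F` over `[a, b]`. -/
def invInt (F : ℝ → ℝ) (a b : ℝ) : ℝ := ∫ x in a..b, (F x)⁻¹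

/-! ### Integral inequalities for a monotone distribution function. -/

section Analytic

variable {F : ℝ → ℝ}

lemma intervalIntegrable_inv (hF : Monotone F) {a b : ℝ} (hab : a ≤ b) (ha : 0 < F a) :
    IntervalIntegrable (fun x => (F x)⁻¹) volume a b := by
  apply AntitoneOn.intervalIntegrable
  intro x hx y hy hxy
  rw [Set.uIcc_of_le hab] at hx hy
  exact inv_anti₀ (ha.trans_le (hF hx.1)) (hF hxy)

lemma invInt_add (hF : Monotone F) {a b c : ℝ} (hab : a ≤ b) (hbc : b ≤ c) (ha : 0 < F a) :
    invInt F a b + invInt F b c = invInt F a c :=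
  intervalIntegral.integral_add_adjacent_intervals (intervalIntegrable_inv hF hab ha)
    (intervalIntegrable_inv hF hbc (ha.trans_le (hF hab)))

lemma invInt_le (hF : Monotone F) {a b : ℝ} (hab : a ≤ b) (ha : 0 < F a) :
    invInt F a b ≤ (b - a) / F a := by
  have := intervalIntegral.integral_mono_on hab (intervalIntegrable_inv hF hab ha)
    (intervalIntegrable_const (c := (F a)⁻¹)) (fun x hx => inv_anti₀ ha (hF hx.1))
  simpa [invInt, div_eq_mul_inv] using this

lemma le_invInt (hF : Monotone F) {a b : ℝ} (hab : a ≤ b) (ha : 0 < F a) :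
    (b - a) / F b ≤ invInt F a b := by
  have := intervalIntegral.integral_mono_on hab (intervalIntegrable_const (c := (F b)⁻¹))
    (intervalIntegrable_inv hF hab ha)
    (fun x hx => inv_anti₀ (ha.trans_le (hF hx.1)) (hF hx.2))
  simpa [invInt, div_eq_mul_inv] using this

/-- The Cauchy–Schwarz inequality for `F` and `1 / F`. -/
lemma sq_div_invInt_le_integral (hF : Monotone F) {a b : ℝ} (hab : a < b) (ha : 0 < F a) :
    (b - a) ^ 2 / invInt F a b ≤ ∫ x in a..b, F x := by
  have hb : 0 < F b := ha.trans_le (hF hab.le)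
  have hJ : 0 < invInt F a b :=
    (div_pos (sub_pos.2 hab) hb).trans_le (le_invInt hF hab.le ha)
  -- The pointwise bound `F ≥ 2c - c² / F` is integrated; this `c` maximizes the resulting lower
  -- bound.
  set c := (b - a) / invInt F a b with hc
  have hi := intervalIntegrable_inv hF hab.le ha
  have h := intervalIntegral.integral_mono_on hab.le
    ((intervalIntegrable_const (c := 2 * c)).sub (hi.const_mul (c ^ 2)))
    (hF.intervalIntegrable (μ := volume)) (fun x hx => by
      have hx0 : 0 < F x := ha.trans_le (hF hx.1)
      have : F x - (2 * c - c ^ 2 * (F x)⁻¹) = (F x - c) ^ 2 / F x := by field_simp; ring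
      have h2 : 0 ≤ (F x - c) ^ 2 / F x := by positivity
      linarith)
  refine le_trans (le_of_eq ?_) h
  rw [intervalIntegral.integral_sub intervalIntegrable_const (hi.const_mul _),
    intervalIntegral.integral_const, intervalIntegral.integral_const_mul]
  change _ = _ - c ^ 2 * invInt F a b
  rw [hc, smul_eq_mul]
  field_simp
  ring

/-- The slope with which the potential grows along the distribution function `F`. -/
def slope (α : ℝ) (F : ℝ → ℝ) (v : ℝ) : ℝ :=
  (2 - α) * F (α * v) * invInt F (α * v) v - (1 - α) ^ 2 * v

/-- Riemann–Stieltjes sums of `slope α F` against `F`, on the grid `t, t + δ, t + 2 * δ, …`. -/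
def potential (α : ℝ) (F : ℝ → ℝ) (t δ : ℝ) (K : ℕ) : ℝ :=
  (∫ x in (0 : ℝ)..t, F x) - (1 - α) ^ 2 * t * F t +
    ∑ k ∈ Finset.range K, (F (t + (k + 1) * δ) - F (t + k * δ)) * slope α F (t + k * δ)

/-- The lower bound on the potential coming from integration by parts. -/
def potentialBound (α : ℝ) (F : ℝ → ℝ) (v : ℝ) : ℝ :=
  (∫ x in (0 : ℝ)..v, F x) - (1 - α) ^ 2 * v * F v -
    (2 - α) * F (α * v) * (v - F v * invInt F (α * v) v)

variable {α t : ℝ}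

/-- One cell `[v, w]` of the integration by parts, with `f, f'` for `F` and `c, c'` for `F (α * ·)`
at the two ends. `A` and `B` are the amounts that `J` gains at the upper and loses at the lower
limit. The two subtracted terms are products of increments, hence of second order. -/
lemma parts_step {v w f f' c c' J A B κ : ℝ} (hα0 : 0 < α) (hvw : v ≤ w) (hc : 0 < c)
    (hcf : c ≤ f) (hcc : c ≤ c') (hff : f ≤ f') (hf1 : f' ≤ 1) (hA : A * f ≤ w - v)
    (hB : α * (w - v) ≤ B * c') (hBκ : B ≤ κ) (hJ : f' * (J + A - B) ≤ w) :
    α * (w - v) * f' - c' * (w - f' * (J + A - B)) + c * (v - f * J) - (w - v) * (f' - f)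
      - κ * (c' - c) ≤ (f' - f) * (c * J) := by
  have hd : 0 ≤ w - v := by linarith
  have hB1 : 0 ≤ B := by
    have := (mul_nonneg hα0.le hd).trans hB
    exact nonneg_of_mul_nonneg_left this (hc.trans_le hcc)
  have hcA : c * A ≤ w - v := by
    rcases le_total 0 A with h | h
    · have := mul_le_mul_of_nonneg_right hcf h
      linarith
    · exact (mul_nonpos_of_nonneg_of_nonpos hc.le h).trans hd
  have hA0 : f' * c * A ≤ c * (w - v) + (w - v) * (f' - f) := by
    have h1 := mul_le_mul_of_nonneg_left hcA (sub_nonneg.2 hff)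
    have h2 := mul_le_mul_of_nonneg_left hA hc.le
    linarith
  have hB0 : α * (w - v) * f' - (c' - c) * κ ≤ f' * c * B := by
    have hfB : f' * B ≤ κ := (mul_le_of_le_one_left hB1 hf1).trans hBκ
    have h1 := mul_le_mul_of_nonneg_left hfB (sub_nonneg.2 hcc)
    have h2 := mul_le_mul_of_nonneg_left hB (hc.le.trans (hcf.trans hff))
    linarith
  have hc' := mul_le_mul_of_nonneg_right hcc (sub_nonneg.2 hJ)
  linarith

/-- Formally, in `d(potentialBound)` the `F dv` terms cancel because `1 - (1 - α)² = (2 - α) α`.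
This leaves `slope dF` and `-(2 - α) (v - F J) d(F(α v))`, whose sign is controlled by balance. -/
lemma potentialBound_step (hF : Monotone F) (h1 : ∀ x, F x ≤ 1) (hα0 : 0 < α)
    (hα1 : α < 1) (ht : 0 < t) (hpos : 0 < F (α * t))
    (hJ : ∀ v, t ≤ v → F v * invInt F (α * v) v ≤ v) {v w : ℝ} (hv : t ≤ v) (hvw : v ≤ w) :
    potentialBound α F w - potentialBound α F v
      - (2 - α) * ((w - v) * (F w - F v) + α / F (α * t) * (w - v) * (F (α * w) - F (α * v)))
      ≤ (F w - F v) * slope α F v := by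
  have hv0 : 0 < v := ht.trans_le hv
  have hcv : F (α * t) ≤ F (α * v) := hF (by gcongr)
  have hcw : F (α * v) ≤ F (α * w) := hF (by gcongr)
  have hcv0 : 0 < F (α * v) := hpos.trans_le hcv
  have hcF : F (α * v) ≤ F v := hF (by nlinarith)
  have hFw : F v ≤ F w := hF hvw
  have hv1 : 0 < F v := hcv0.trans_le hcF
  have hαvw : α * v ≤ α * w := by gcongr
  -- increments of the integrals
  set A := invInt F v w with hA
  set B := invInt F (α * v) (α * w) with hB
  set J := invInt F (α * v) v with hJdef
  set J' := invInt F (α * w) w with hJ'def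
  have hJJ : J' = J + A - B := by
    have e1 := invInt_add hF (show α * v ≤ v by nlinarith) hvw hcv0
    have e2 := invInt_add hF hαvw (show α * w ≤ w by nlinarith) hcv0
    linarith
  have hAle : A ≤ (w - v) / F v := invInt_le hF hvw hv1
  have hBge : (α * w - α * v) / F (α * w) ≤ B := le_invInt hF hαvw hcv0
  have hBle : B ≤ α / F (α * t) * (w - v) := by
    refine (invInt_le hF hαvw hcv0).trans ?_
    rw [div_mul_eq_mul_div, ← mul_sub]
    have : 0 ≤ α * (w - v) := mul_nonneg hα0.le (by linarith)
    gcongr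
  have hint : (∫ x in (0 : ℝ)..w, F x) - (∫ x in (0 : ℝ)..v, F x) ≤ (w - v) * F w := by
    rw [intervalIntegral.integral_interval_sub_left hF.intervalIntegrable hF.intervalIntegrable]
    have := intervalIntegral.integral_mono_on hvw (hF.intervalIntegrable (μ := volume))
      (intervalIntegrable_const (c := F w)) (fun x hx => hF hx.2)
    simpa using this
  have hJw := hJ w (hv.trans hvw)
  rw [← hJ'def] at hJw
  have hAF : A * F v ≤ w - v := by rwa [le_div_iff₀ hv1] at hAle
  have hBF : α * (w - v) ≤ B * F (α * w) := by
    rw [div_le_iff₀ (hcv0.trans_le hcw)] at hBge; linarith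
  have key := parts_step hα0 hvw hcv0 hcF hcw hFw (h1 w) hAF hBF hBle (hJJ ▸ hJw) (J := J)
  have h2α : 0 ≤ 2 - α := by linarith
  have key' := mul_le_mul_of_nonneg_left key h2α
  rw [← hJJ] at key'
  unfold potentialBound slope
  rw [← hJdef, ← hJ'def]
  linarith

/-- With constant mesh the second-order errors telescope, so the total error is `O(δ)` even when `F`
has jumps. -/
lemma potentialBound_le_potential (hF : Monotone F) (h1 : ∀ x, F x ≤ 1) (hα0 : 0 < α)
    (hα1 : α < 1) (ht : 0 < t) (hpos : 0 < F (α * t))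
    (hJ : ∀ v, t ≤ v → F v * invInt F (α * v) v ≤ v) {δ : ℝ} (hδ : 0 ≤ δ) (K : ℕ) :
    potentialBound α F (t + K * δ)
      - (2 - α) * δ * ((F (t + K * δ) - F t)
        + α / F (α * t) * (F (α * (t + K * δ)) - F (α * t)))
      ≤ potential α F t δ K := by
  induction K with
  | zero =>
    simp only [potentialBound, potential, Nat.cast_zero, zero_mul, add_zero, sub_self, mul_zero,
      Finset.range_zero, Finset.sum_empty, sub_zero]
    have := mul_nonneg (mul_nonneg (by linarith : (0 : ℝ) ≤ 2 - α) hpos.le)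
      (sub_nonneg.2 (hJ t le_rfl))
    linarith
  | succ K ih =>
    have hs : potential α F t δ (K + 1) = potential α F t δ K
        + (F (t + (K + 1) * δ) - F (t + K * δ)) * slope α F (t + K * δ) := by
      simp only [potential, Finset.sum_range_succ]; ring
    have hKδ : 0 ≤ K * δ := by positivity
    have := potentialBound_step hF h1 hα0 hα1 ht hpos hJ (v := t + K * δ)
      (w := t + (K + 1) * δ) (by linarith) (by nlinarith)
    rw [hs]
    push_cast
    have e : t + (K + 1) * δ - (t + K * δ) = δ := by ring
    rw [e] at this
    nlinarith

/-- The integral of `F` over `[α v, v]` is replaced by its Cauchy–Schwarz lower bound `(1 - α)² v² /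
J`; the resulting expression factors. -/
lemma slope_mul_le_potentialBound (hF : Monotone F) (h0 : ∀ x, 0 ≤ F x) (hα0 : 0 < α)
    (hα1 : α < 1) {v : ℝ} (hv : 0 < v) (hpos : 0 < F (α * v)) :
    (v / invInt F (α * v) v - F v) * (-slope α F v) ≤ potentialBound α F v := by
  have hαv : α * v < v := by nlinarith
  have hFv : 0 < F v := hpos.trans_le (hF hαv.le)
  have hJ : 0 < invInt F (α * v) v :=
    (div_pos (sub_pos.2 hαv) hFv).trans_le (le_invInt hF hαv.le hpos)
  have hcs := sq_div_invInt_le_integral hF hαv hpos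
  have hI : (∫ x in (α * v)..v, F x) ≤ ∫ x in (0 : ℝ)..v, F x := by
    have h := intervalIntegral.integral_interval_sub_left (a := 0) (b := v) (c := α * v)
      (hF.intervalIntegrable (μ := volume)) hF.intervalIntegrable
    have : 0 ≤ ∫ x in (0 : ℝ)..(α * v), F x :=
      intervalIntegral.integral_nonneg (by positivity) (fun x _ => h0 x)
    linarith
  have e : (v / invInt F (α * v) v - F v) * (-slope α F v)
      = (v - α * v) ^ 2 / invInt F (α * v) v - (1 - α) ^ 2 * v * F v
        - (2 - α) * F (α * v) * (v - F v * invInt F (α * v) v) := by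
    unfold slope
    generalize invInt F (α * v) v = J at *
    field_simp
    ring
  rw [e, potentialBound]
  linarith

lemma le_div_sub_mul {v J f p ε : ℝ} (hJ : 0 < J) (hε : 0 ≤ ε) (hp : 0 ≤ p) (hpJ : p ≤ J)
    (h : f * J ≤ v + ε) : -ε ≤ (v / J - f) * p := by
  have e : (v / J - f) * p = (v - f * J) * (p / J) := by field_simp
  rw [e]
  have h1 : p / J ≤ 1 := (div_le_one hJ).2 hpJ
  have h0 : 0 ≤ p / J := div_nonneg hp hJ.le
  nlinarith

/-- Induction along the grid, split by the sign of the slope. A negative slope is absorbed by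
`potentialBound` at the left end of the cell, so errors do not accumulate from step to step. -/
lemma potential_lower_bound (hF : Monotone F) (h0 : ∀ x, 0 ≤ F x) (h1 : ∀ x, F x ≤ 1)
    (hα0 : 0 < α) (hα1 : α < 1) (ht : 0 < t) (hpos : 0 < F (α * t))
    (hJ : ∀ v, t ≤ v → F v * invInt F (α * v) v ≤ v) {δ : ℝ} (hδ : 0 ≤ δ) (K : ℕ) :
    -(3 * (1 + α / F (α * t)) * δ) ≤ potential α F t δ K := by
  set κ := α / F (α * t) with hκ
  have hκ0 : 0 < κ := div_pos hα0 hpos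
  induction K with
  | zero =>
    have h := slope_mul_le_potentialBound hF h0 hα0 hα1 ht hpos
    have hαt : α * t < t := by nlinarith
    have hFt : 0 < F t := hpos.trans_le (hF hαt.le)
    have hJt : 0 < invInt F (α * t) t :=
      (div_pos (sub_pos.2 hαt) hFt).trans_le (le_invInt hF hαt.le hpos)
    have hcs := sq_div_invInt_le_integral hF hαt hpos
    have hI : (∫ x in (α * t)..t, F x) ≤ ∫ x in (0 : ℝ)..t, F x := by
      have h := intervalIntegral.integral_interval_sub_left (a := 0) (b := t) (c := α * t)
        (hF.intervalIntegrable (μ := volume)) hF.intervalIntegrable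
      have : 0 ≤ ∫ x in (0 : ℝ)..(α * t), F x :=
        intervalIntegral.integral_nonneg (by positivity) (fun x _ => h0 x)
      linarith
    have h5 : (1 - α) ^ 2 * t * F t ≤ (t - α * t) ^ 2 / invInt F (α * t) t := by
      rw [le_div_iff₀ hJt]
      have := mul_le_mul_of_nonneg_left (hJ t le_rfl) (show 0 ≤ (1 - α) ^ 2 * t by positivity)
      nlinarith
    have h6 : 0 ≤ 3 * (1 + κ) * δ := by positivity
    simp only [potential, Finset.range_zero, Finset.sum_empty, add_zero]
    linarith
  | succ K ih =>
    have hs : potential α F t δ (K + 1) = potential α F t δ K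
        + (F (t + (K + 1) * δ) - F (t + K * δ)) * slope α F (t + K * δ) := by
      simp only [potential, Finset.sum_range_succ]; ring
    have hKδ : 0 ≤ K * δ := by positivity
    set v := t + K * δ with hv
    set w := t + (K + 1) * δ with hw
    have hwv : w = v + δ := by rw [hw, hv]; ring
    have htv : t ≤ v := by linarith
    have hv0 : 0 < v := ht.trans_le htv
    have hFvw : F v ≤ F w := hF (by linarith)
    -- A nonnegative slope only increases the potential; below, the induction hypothesis is
    -- discarded.
    rcases le_total 0 (slope α F v) with hφ | hφ
    · rw [hs]
      have := mul_nonneg (sub_nonneg.2 hFvw) hφ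
      linarith
    have hcv : F (α * t) ≤ F (α * v) := hF (by gcongr)
    have hcv0 : 0 < F (α * v) := hpos.trans_le hcv
    have hαv : α * v < v := by nlinarith
    have hαvw : α * v ≤ α * w := by rw [hwv]; nlinarith
    have hFv : 0 < F v := hcv0.trans_le (hF hαv.le)
    have hP := potentialBound_le_potential hF h1 hα0 hα1 ht hpos hJ hδ K
    rw [← hv, ← hκ] at hP
    have hQ := slope_mul_le_potentialBound hF h0 hα0 hα1 hv0 hcv0
    have hJlow := le_invInt hF hαv.le hcv0
    have hJ1 : (1 - α) * v ≤ invInt F (α * v) v := by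
      refine le_trans ?_ hJlow
      rw [le_div_iff₀ hFv]
      have : 0 ≤ (1 - α) * v := by nlinarith
      nlinarith [h1 v]
    have hJ0 : 0 < invInt F (α * v) v := lt_of_lt_of_le (by nlinarith) hJ1
    have hB : invInt F (α * v) (α * w) ≤ κ * δ := by
      refine (invInt_le hF hαvw hcv0).trans ?_
      rw [← mul_sub, hwv, add_sub_cancel_left, hκ, div_mul_eq_mul_div]
      gcongr
    have hstep : invInt F (α * v) v ≤ invInt F (α * w) w + κ * δ := by
      have e1 := invInt_add hF hαv.le (show v ≤ w by linarith) hcv0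
      have e2 := invInt_add hF hαvw (show α * w ≤ w by nlinarith) hcv0
      have : 0 ≤ invInt F v w :=
        intervalIntegral.integral_nonneg (by linarith) (fun x _ => inv_nonneg.2 (h0 x))
      linarith
    have hFJ : F w * invInt F (α * v) v ≤ v + (1 + κ) * δ := by
      have h7 := hJ w (by linarith)
      have h8 : F w * (κ * δ) ≤ κ * δ := mul_le_of_le_one_left (by positivity) (h1 w)
      have h9 := mul_le_mul_of_nonneg_left hstep (h0 w)
      rw [hwv] at h7 h8 h9 ⊢
      linarith
    -- `F w` rather than `F v` appears because the cell's own increment `(F w - F v) * slope` has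
    -- been merged in. Since `-slope ≤ J`, a defect of `(1 + κ) δ` in balance costs no more than
    -- that.
    have hmain : -((1 + κ) * δ) ≤ (v / invInt F (α * v) v - F w) * (-slope α F v) := by
      have hφ' : -slope α F v ≤ (1 - α) ^ 2 * v := by
        have : 0 ≤ (2 - α) * F (α * v) * invInt F (α * v) v :=
          mul_nonneg (mul_nonneg (by linarith) hcv0.le) hJ0.le
        unfold slope; linarith
      have hφ'' : -slope α F v ≤ invInt F (α * v) v := by
        have : 0 ≤ α * ((1 - α) * v) := mul_nonneg hα0.le (mul_nonneg (by linarith) hv0.le)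
        linarith
      exact le_div_sub_mul hJ0 (by positivity) (neg_nonneg.2 hφ) hφ'' hFJ
    have herr : (2 - α) * δ * ((F v - F t) + κ * (F (α * v) - F (α * t)))
        ≤ 2 * (1 + κ) * δ := by
      have h11 : (F v - F t) + κ * (F (α * v) - F (α * t)) ≤ 1 + κ := by
        have := mul_le_mul_of_nonneg_left
          (show F (α * v) - F (α * t) ≤ 1 by linarith [h1 (α * v)]) hκ0.le
        linarith [h1 v, h0 t]
      have h12 : 0 ≤ (2 - α) * δ := mul_nonneg (by linarith) hδ
      have h13 := mul_le_mul_of_nonneg_left h11 h12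
      have h14 : 0 ≤ α * ((1 + κ) * δ) := by positivity
      linarith
    rw [hs]
    linarith

end Analytic

/-! ### Threshold rewards on a fixed realization. -/

section Realization

variable {n : ℕ} {R : Fin n → ℝ} {τ x : ℝ}

lemma le_realizedMax (R : Fin n → ℝ) (i : Fin n) : R i ≤ realizedMax R :=
  le_ciSup (Set.finite_range R).bddAbove i

lemma realizedMax_nonneg (h : ∀ i, 0 ≤ R i) : 0 ≤ realizedMax R := Real.iSup_nonneg h

lemma realizedMax_le_iff [Nonempty (Fin n)] : realizedMax R ≤ x ↔ ∀ i, R i ≤ x :=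
  ciSup_le_iff (Set.finite_range R).bddAbove

lemma exists_eq_realizedMax [Nonempty (Fin n)] (R : Fin n → ℝ) : ∃ i, R i = realizedMax R :=
  exists_eq_ciSup_of_finite

lemma realizedMax_lt_iff [Nonempty (Fin n)] : realizedMax R < x ↔ ∀ i, R i < x := by
  obtain ⟨i, hi⟩ := exists_eq_realizedMax R
  exact ⟨fun h j => (le_realizedMax R j).trans_lt h, fun h => hi ▸ h i⟩

lemma le_realizedMax_iff [Nonempty (Fin n)] : x ≤ realizedMax R ↔ ∃ i, x ≤ R i := by
  rw [← not_lt, realizedMax_lt_iff]; push Not; rfl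

lemma exists_thrReward_eq (h : ∃ i, τ ≤ R i) :
    ∃ i, thrReward R τ = R i ∧ τ ≤ R i ∧ ∀ j < i, R j < τ := by
  classical
  refine ⟨Fin.find (fun i => τ ≤ R i) h, ?_, Fin.find_spec h, fun j hj => ?_⟩
  · rw [thrReward, dif_pos h]
  · exact not_le.1 (Fin.find_min h hj)

lemma thrReward_of_not_exists (h : ¬ ∃ i, τ ≤ R i) : thrReward R τ = 0 := by
  rw [thrReward, dif_neg h]

lemma thrReward_of_first {i : Fin n} (h : τ ≤ R i) (hlt : ∀ j < i, R j < τ) :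
    thrReward R τ = R i := by
  obtain ⟨k, hk, hk1, hk2⟩ := exists_thrReward_eq ⟨i, h⟩
  rcases lt_trichotomy k i with hki | rfl | hki
  · exact absurd (hlt k hki) (not_lt.2 hk1)
  · exact hk
  · exact absurd (hk2 i hki) (not_lt.2 h)

lemma thrReward_nonneg (hR : ∀ i, 0 ≤ R i) : 0 ≤ thrReward R τ := by
  by_cases h : ∃ i, τ ≤ R i
  · obtain ⟨i, hi, -⟩ := exists_thrReward_eq h
    exact hi ▸ hR i
  · exact (thrReward_of_not_exists h).ge

lemma thrReward_le_realizedMax (hR : ∀ i, 0 ≤ R i) : thrReward R τ ≤ realizedMax R := by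
  by_cases h : ∃ i, τ ≤ R i
  · obtain ⟨i, hi, -⟩ := exists_thrReward_eq h
    exact hi ▸ le_realizedMax R i
  · exact (thrReward_of_not_exists h).trans_le (realizedMax_nonneg hR)

lemma abs_thrReward_le : |thrReward R τ| ≤ ∑ i, |R i| := by
  by_cases h : ∃ i, τ ≤ R i
  · obtain ⟨i, hi, -⟩ := exists_thrReward_eq h
    exact hi ▸ Finset.single_le_sum (f := fun i => |R i|) (fun _ _ => abs_nonneg _)
      (Finset.mem_univ i)
  · rw [thrReward_of_not_exists h, abs_zero]
    exact Finset.sum_nonneg fun _ _ => abs_nonneg _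

lemma abs_realizedMax_le [Nonempty (Fin n)] : |realizedMax R| ≤ ∑ i, |R i| := by
  obtain ⟨i, hi⟩ := exists_eq_realizedMax R
  exact hi ▸ Finset.single_le_sum (f := fun i => |R i|) (fun _ _ => abs_nonneg _)
    (Finset.mem_univ i)

open Classical in
lemma thrReward_eq_sum : thrReward R τ =
    ∑ i, if τ ≤ R i ∧ ∀ j < i, R j < τ then R i else 0 := by
  by_cases h : ∃ i, τ ≤ R i
  · obtain ⟨i, hi, hi1, hi2⟩ := exists_thrReward_eq h
    rw [Finset.sum_eq_single i, if_pos ⟨hi1, hi2⟩, hi]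
    · intro j _ hji
      rw [if_neg]
      rintro ⟨h1, h2⟩
      rcases lt_or_gt_of_ne hji with hj | hj
      · exact absurd (hi2 j hj) (not_lt.2 h1)
      · exact absurd (h2 i hj) (not_lt.2 hi1)
    · simp
  · rw [thrReward_of_not_exists h, Finset.sum_eq_zero]
    intro i _
    rw [if_neg]
    exact fun h' => h ⟨i, h'.1⟩

/-- If the threshold is between `a` and the maximum and no value lies in `[a, x)`, then the
threshold algorithm obtains at least `x`. -/
lemma le_thrReward [Nonempty (Fin n)] {a : ℝ} (ha : a ≤ τ) (hτ : τ ≤ realizedMax R)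
    (hx : ∀ i, a ≤ R i → x ≤ R i) : x ≤ thrReward R τ := by
  obtain ⟨i, hi, hi1, -⟩ := exists_thrReward_eq (le_realizedMax_iff.1 hτ)
  exact hi ▸ hx i (ha.trans hi1)

end Realization

/-! ### A product inequality for independent coordinates. -/

section Products

/-- In one coordinate, `z - (x - a) ≥ (a / x) z` whenever `z ≥ x`: removing mass `x - a` hurts a
larger set relatively less. -/
lemma prod_shift_sub_le {ι : Type*} (s : Finset ι) {a x y z : ι → ℝ} (ha : ∀ i, 0 ≤ a i)
    (hax : ∀ i, a i ≤ x i) (hxy : ∀ i, x i ≤ y i) (hyz : ∀ i, y i ≤ z i) (hx : ∀ i, 0 < x i) :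
    (∏ i ∈ s, a i) / (∏ i ∈ s, x i) * (∏ i ∈ s, z i - ∏ i ∈ s, y i)
      ≤ ∏ i ∈ s, (z i - (x i - a i)) - ∏ i ∈ s, (y i - (x i - a i)) := by
  classical
  -- The bound for the `y`-product alone is carried along: a new factor in the difference produces
  -- the cross term `(z i - y i) * ∏ y`.
  suffices h : (∏ i ∈ s, a i) / (∏ i ∈ s, x i) * (∏ i ∈ s, z i - ∏ i ∈ s, y i)
      ≤ ∏ i ∈ s, (z i - (x i - a i)) - ∏ i ∈ s, (y i - (x i - a i)) ∧
      (∏ i ∈ s, a i) / (∏ i ∈ s, x i) * ∏ i ∈ s, y i ≤ ∏ i ∈ s, (y i - (x i - a i)) from h.1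
  induction s using Finset.induction_on with
  | empty => simp
  | insert i s hi ih =>
    obtain ⟨ih1, ih2⟩ := ih
    simp only [Finset.prod_insert hi, mul_div_mul_comm]
    have hY : ∏ i ∈ s, y i ≤ ∏ i ∈ s, z i :=
      Finset.prod_le_prod (fun i _ => (hx i).le.trans (hxy i)) (fun i _ => hyz i)
    have hY0 : 0 ≤ ∏ i ∈ s, y i := Finset.prod_nonneg fun i _ => (hx i).le.trans (hxy i)
    have hρ : 0 ≤ (∏ i ∈ s, a i) / (∏ i ∈ s, x i) :=
      div_nonneg (Finset.prod_nonneg fun i _ => ha i) (Finset.prod_nonneg fun i _ => (hx i).le)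
    have hr0 : 0 ≤ a i / x i := div_nonneg (ha i) (hx i).le
    have hr1 : a i / x i ≤ 1 := (div_le_one (hx i)).2 (hax i)
    have hrx : x i - a i = x i * (1 - a i / x i) := by have := (hx i).ne'; field_simp
    have hrz : a i / x i * z i ≤ z i - (x i - a i) := by
      rw [hrx]; nlinarith [hxy i, hyz i]
    have hry : a i / x i * y i ≤ y i - (x i - a i) := by
      rw [hrx]; nlinarith [hxy i]
    have hz0 : 0 ≤ z i := (hx i).le.trans ((hxy i).trans (hyz i))
    have hy0 : 0 ≤ y i := (hx i).le.trans (hxy i)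
    set ρ := (∏ i ∈ s, a i) / (∏ i ∈ s, x i)
    set r := a i / x i
    set Y := ∏ i ∈ s, y i
    set Z := ∏ i ∈ s, z i
    set A := ∏ i ∈ s, (z i - (x i - a i))
    set B := ∏ i ∈ s, (y i - (x i - a i))
    constructor
    · have e1 : r * z i * (ρ * (Z - Y)) ≤ (z i - (x i - a i)) * (A - B) :=
        mul_le_mul hrz ih1 (mul_nonneg hρ (sub_nonneg.2 hY))
          ((mul_nonneg hr0 hz0).trans hrz)
      have e2 : r * (ρ * Y) * (z i - y i) ≤ B * (z i - y i) := by
        apply mul_le_mul_of_nonneg_right _ (sub_nonneg.2 (hyz i))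
        exact (mul_le_of_le_one_left (mul_nonneg hρ hY0) hr1).trans ih2
      linarith
    · have e1 : r * y i * (ρ * Y) ≤ (y i - (x i - a i)) * B :=
        mul_le_mul hry ih2 (mul_nonneg hρ hY0) ((mul_nonneg hr0 hy0).trans hry)
      linarith

end Products

/-! ### Layer-cake comparison on bounded intervals. -/

section LayerCake

variable {Ω : Type*} [MeasurableSpace Ω] {μ : Measure Ω} [IsFiniteMeasure μ] {f : Ω → ℝ}

lemma antitone_measureReal_le (f : Ω → ℝ) : Antitone fun x => μ.real {ω | x ≤ f ω} :=
  fun _ _ hxy => measureReal_mono fun _ h => hxy.trans h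

lemma intervalIntegral_le_integral_of_le_measureReal (hf : Integrable f μ) (h0 : 0 ≤ᵐ[μ] f)
    {b : ℝ} (hb : 0 ≤ b) {h : ℝ → ℝ} (hh : IntervalIntegrable h volume 0 b)
    (hle : ∀ x, 0 < x → x < b → h x ≤ μ.real {ω | x ≤ f ω}) :
    ∫ x in (0 : ℝ)..b, h x ≤ ∫ ω, f ω ∂μ := by
  have hg : Integrable (fun ω => min (f ω) b) μ := hf.inf (integrable_const b)
  have h1 : ∫ ω, min (f ω) b ∂μ ≤ ∫ ω, f ω ∂μ :=
    integral_mono hg hf fun ω => min_le_left _ _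
  refine le_trans ?_ h1
  rw [hg.integral_eq_integral_Ioc_meas_le (M := b)
    (by filter_upwards [h0] with ω hω using le_min hω hb)
    (Filter.Eventually.of_forall fun ω => min_le_right _ _),
    ← intervalIntegral.integral_of_le hb]
  apply intervalIntegral.integral_mono_on_of_le_Ioo hb hh
    (antitone_measureReal_le _).intervalIntegrable
  intro x hx
  refine (hle x hx.1 hx.2).trans (measureReal_mono fun ω hω => ?_)
  exact le_min hω hx.2.le

lemma integral_le_intervalIntegral_of_measureReal_le (hf : Integrable f μ) (h0 : 0 ≤ᵐ[μ] f)
    {b : ℝ} (hb : 0 ≤ b) (hfb : ∀ᵐ ω ∂μ, f ω ≤ b) {h : ℝ → ℝ}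
    (hh : IntervalIntegrable h volume 0 b)
    (hle : ∀ x, 0 < x → x < b → μ.real {ω | x ≤ f ω} ≤ h x) :
    ∫ ω, f ω ∂μ ≤ ∫ x in (0 : ℝ)..b, h x := by
  rw [hf.integral_eq_integral_Ioc_meas_le h0 hfb, ← intervalIntegral.integral_of_le hb]
  exact intervalIntegral.integral_mono_on_of_le_Ioo hb
    (antitone_measureReal_le _).intervalIntegrable hh fun x hx => hle x hx.1 hx.2

end LayerCake

/-! ### Distribution of the maximum and measurability of rewards. -/

section Instance

variable {Ω : Type*} [MeasurableSpace Ω] {μ : Measure Ω}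
  {n : ℕ} {X : Fin n → Ω → ℝ}

/-- The probability that all variables take values in `U`. -/
def allIn (μ : Measure Ω) (X : Fin n → Ω → ℝ) (U : Set ℝ) : ℝ :=
  μ.real {ω | ∀ i, X i ω ∈ U}

/-- The probability that all variables are smaller than `x`. -/
def cdfLT (μ : Measure Ω) (X : Fin n → Ω → ℝ) (x : ℝ) : ℝ := allIn μ X (Set.Iio x)

lemma allIn_nonneg (U : Set ℝ) : 0 ≤ allIn μ X U := measureReal_nonneg

lemma allIn_le_one [IsProbabilityMeasure μ] (U : Set ℝ) : allIn μ X U ≤ 1 := measureReal_le_one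

lemma allIn_mono [IsProbabilityMeasure μ] {U V : Set ℝ} (h : U ⊆ V) : allIn μ X U ≤ allIn μ X V :=
  measureReal_mono fun _ hω i => h (hω i)

lemma cdfLT_mono [IsProbabilityMeasure μ] : Monotone (cdfLT μ X) := fun _ _ h => allIn_mono
    (Set.Iio_subset_Iio h)

lemma measurableSet_allIn (hm : ∀ i, Measurable (X i)) {U : Set ℝ} (hU : MeasurableSet U) :
    MeasurableSet {ω | ∀ i, X i ω ∈ U} := by
  rw [Set.ofPred_forall]
  exact MeasurableSet.iInter fun i => hm i hU

lemma allIn_eq_prod (hindep : iIndepFun X μ) {U : Set ℝ} (hU : MeasurableSet U) :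
    allIn μ X U = ∏ i, μ.real (X i ⁻¹' U) := by
  have := hindep.meas_iInter (s := fun i => X i ⁻¹' U) (fun i => ⟨U, hU, rfl⟩)
  rw [allIn, Set.ofPred_forall, measureReal_def]
  change (μ (⋂ i, X i ⁻¹' U)).toReal = _
  rw [this, ENNReal.toReal_prod]
  rfl

/-- Given that the maximum is at least `y` and lies in `U`, the values avoid `[a, x)` with
probability at least `P(M < a) / P(M < x)`. -/
lemma cdfLT_div_mul_le [IsProbabilityMeasure μ] (hm : ∀ i, Measurable (X i))
    (hindep : iIndepFun X μ) {U : Set ℝ} (hU : MeasurableSet U) {a x y : ℝ} (hax : a ≤ x)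
    (hxy : x ≤ y) (hyU : Set.Iio y ⊆ U)
    (hx : 0 < cdfLT μ X x) :
    cdfLT μ X a / cdfLT μ X x * (allIn μ X U - cdfLT μ X y)
      ≤ μ.real {ω | (∀ i, X i ω ∈ U) ∧ (∃ i, y ≤ X i ω) ∧ ∀ i, a ≤ X i ω → x ≤ X i ω} := by
  -- Removing `[a, x)` costs coordinate `i` the same mass from every `V ⊇ (-∞, x)`, which is the
  -- common shift in `prod_shift_sub_le`.
  have hsub : ∀ V : Set ℝ, MeasurableSet V → Set.Iio x ⊆ V → ∀ i,
      μ.real (X i ⁻¹' (V \ Set.Ico a x))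
        = μ.real (X i ⁻¹' V) - (μ.real (X i ⁻¹' Set.Iio x) - μ.real (X i ⁻¹' Set.Iio a)) := by
    intro V hV hxV i
    have e1 : μ.real (X i ⁻¹' V \ X i ⁻¹' Set.Ico a x)
        = μ.real (X i ⁻¹' V) - μ.real (X i ⁻¹' Set.Ico a x) :=
      measureReal_sdiff (Set.preimage_mono (Set.Ico_subset_Iio_self.trans hxV))
        (hm i measurableSet_Ico)
    have e2 : μ.real (X i ⁻¹' Set.Iio x \ X i ⁻¹' Set.Iio a)
        = μ.real (X i ⁻¹' Set.Iio x) - μ.real (X i ⁻¹' Set.Iio a) :=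
      measureReal_sdiff (Set.preimage_mono (Set.Iio_subset_Iio hax)) (hm i measurableSet_Iio)
    rw [Set.preimage_sdiff, e1, ← e2, ← Set.preimage_sdiff, Set.Iio_sdiff_Iio]
  have hyx : Set.Iio x ⊆ Set.Iio y := Set.Iio_subset_Iio hxy
  have hmU : MeasurableSet (U \ Set.Ico a x) := hU.diff measurableSet_Ico
  have hmy : MeasurableSet (Set.Iio y \ Set.Ico a x) := measurableSet_Iio.diff measurableSet_Ico
  have hset : {ω | (∀ i, X i ω ∈ U) ∧ (∃ i, y ≤ X i ω) ∧ ∀ i, a ≤ X i ω → x ≤ X i ω}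
      = {ω | ∀ i, X i ω ∈ U \ Set.Ico a x} \ {ω | ∀ i, X i ω ∈ Set.Iio y \ Set.Ico a x} := by
    ext ω
    simp only [Set.mem_ofPred_eq, Set.mem_sdiff, Set.mem_Ico, Set.mem_Iio]
    constructor
    · rintro ⟨h1, ⟨j, hj⟩, h3⟩
      exact ⟨fun i => ⟨h1 i, fun h => absurd (h3 i h.1) (not_le.2 h.2)⟩,
        fun h => absurd (h j).1 (not_lt.2 hj)⟩
    · rintro ⟨h1, h2⟩
      have h3 : ∀ i, a ≤ X i ω → x ≤ X i ω := fun i hi => by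
        by_contra hc
        exact (h1 i).2 ⟨hi, not_le.1 hc⟩
      refine ⟨fun i => (h1 i).1, ?_, h3⟩
      by_contra hc
      push Not at hc
      exact h2 fun i => ⟨hc i, (h1 i).2⟩
  rw [hset, measureReal_sdiff (fun ω hω i => ⟨hyU (hω i).1, (hω i).2⟩)
    (measurableSet_allIn hm hmy)]
  change _ ≤ allIn μ X _ - allIn μ X _
  unfold cdfLT at *
  rw [allIn_eq_prod hindep hmU, allIn_eq_prod hindep hmy, allIn_eq_prod hindep hU,
    allIn_eq_prod hindep measurableSet_Iio, allIn_eq_prod hindep measurableSet_Iio,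
    allIn_eq_prod hindep measurableSet_Iio]
  rw [Finset.prod_congr rfl fun i _ => hsub U hU (hyx.trans hyU) i,
    Finset.prod_congr rfl fun i _ => hsub (Set.Iio y) measurableSet_Iio hyx i]
  refine prod_shift_sub_le _ (fun i => measureReal_nonneg)
    (fun i => measureReal_mono (Set.preimage_mono (Set.Iio_subset_Iio hax)))
    (fun i => measureReal_mono (Set.preimage_mono hyx))
    (fun i => measureReal_mono (Set.preimage_mono hyU)) (fun i => ?_)
  rw [allIn_eq_prod hindep measurableSet_Iio] at hx
  refine measureReal_nonneg.lt_of_ne fun h => hx.ne' ?_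
  exact Finset.prod_eq_zero (Finset.mem_univ i) h.symm

lemma measurable_realizedMax (hm : ∀ i, Measurable (X i)) :
    Measurable fun ω => realizedMax fun i => X i ω :=
  Measurable.iSup hm

lemma measurable_thrReward (hm : ∀ i, Measurable (X i)) {T : Ω → ℝ} (hT : Measurable T) :
    Measurable fun ω => thrReward (fun i => X i ω) (T ω) := by
  classical
  simp only [thrReward_eq_sum]
  refine Finset.measurable_sum _ fun i _ => Measurable.ite ?_ (hm i) measurable_const
  refine (measurableSet_le hT (hm i)).inter ?_
  have : {ω | ∀ j < i, X j ω < T ω} = ⋂ j, ⋂ (_ : j < i), {ω | X j ω < T ω} := by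
    ext; simp
  change MeasurableSet {ω | ∀ j < i, X j ω < T ω}
  rw [this]
  exact MeasurableSet.iInter fun j => MeasurableSet.iInter fun _ => measurableSet_lt (hm j) hT

lemma integrable_thrReward (hm : ∀ i, Measurable (X i)) (hi : ∀ i, Integrable (X i) μ)
    {T : Ω → ℝ} (hT : Measurable T) :
    Integrable (fun ω => thrReward (fun i => X i ω) (T ω)) μ := by
  refine Integrable.mono' (integrable_finsetSum Finset.univ fun i _ => (hi i).abs)
    (measurable_thrReward hm hT).aestronglyMeasurable (Filter.Eventually.of_forall fun ω => ?_)
  exact abs_thrReward_le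

lemma integrable_realizedMax [Nonempty (Fin n)] (hm : ∀ i, Measurable (X i))
    (hi : ∀ i, Integrable (X i) μ) : Integrable (fun ω => realizedMax fun i => X i ω) μ := by
  refine Integrable.mono' (integrable_finsetSum Finset.univ fun i _ => (hi i).abs)
    (measurable_realizedMax hm).aestronglyMeasurable (Filter.Eventually.of_forall fun ω => ?_)
  exact abs_realizedMax_le

end Instance

/-! ### Reward against prophet value, and the guarantee at a balanced level. -/

section Guarantee

variable {Ω : Type*} [MeasurableSpace Ω] {μ : Measure Ω}
  {n : ℕ} {X : Fin n → Ω → ℝ}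

lemma cdfLT_div_mul_le_measureReal_indicator [IsProbabilityMeasure μ] [Nonempty (Fin n)]
    (hm : ∀ i, Measurable (X i))
    (hindep : iIndepFun X μ) {U : Set ℝ} (hU : MeasurableSet U) {a x y : ℝ} (hxy : max x a ≤ y)
    (hyU : Set.Iio y ⊆ U) (ha : 0 < cdfLT μ X a) {T : Ω → ℝ} {E : Set Ω}
    (hE : ∀ ω, (∀ i, X i ω ∈ U) → (∃ i, y ≤ X i ω) → ω ∈ E)
    (hT : ∀ ω ∈ E, (∃ i, y ≤ X i ω) → a ≤ T ω ∧ T ω ≤ realizedMax fun i => X i ω) :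
    cdfLT μ X a / cdfLT μ X (max x a) * (allIn μ X U - cdfLT μ X y)
      ≤ μ.real {ω | x ≤ E.indicator (fun ω => thrReward (fun i => X i ω) (T ω)) ω} := by
  refine (cdfLT_div_mul_le hm hindep hU (le_max_right x a) hxy hyU
    (ha.trans_le (cdfLT_mono (le_max_right x a)))).trans (measureReal_mono ?_)
  rintro ω ⟨h1, h2, h3⟩
  have hω := hE ω h1 h2
  rw [Set.mem_ofPred_eq, Set.indicator_of_mem hω]
  exact (le_max_left x a).trans (le_thrReward (hT ω hω h2).1 (hT ω hω h2).2 h3)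

lemma ae_thrReward_nonneg (h0 : ∀ i, ∀ᵐ ω ∂μ, 0 ≤ X i ω) (T : Ω → ℝ) :
    ∀ᵐ ω ∂μ, 0 ≤ thrReward (fun i => X i ω) (T ω) := by
  filter_upwards [ae_all_iff.2 h0] with ω hω using thrReward_nonneg hω

lemma ae_indicator_thrReward_nonneg (h0 : ∀ i, ∀ᵐ ω ∂μ, 0 ≤ X i ω) (T : Ω → ℝ) (E : Set Ω) :
    0 ≤ᵐ[μ] E.indicator (fun ω => thrReward (fun i => X i ω) (T ω)) := by
  filter_upwards [ae_thrReward_nonneg h0 T] with ω hω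
  exact Set.indicator_apply_nonneg fun _ => hω

/-- Reward collected while the values stay in `U` by a threshold that is at least `a`. -/
lemma le_setIntegral_thrReward [IsProbabilityMeasure μ] [Nonempty (Fin n)]
    (hm : ∀ i, Measurable (X i))
    (hindep : iIndepFun X μ) (h0 : ∀ i, ∀ᵐ ω ∂μ, 0 ≤ X i ω) (hi : ∀ i, Integrable (X i) μ)
    {U : Set ℝ} (hU : MeasurableSet U) {a s : ℝ} (ha0 : 0 ≤ a) (has : a ≤ s)
    (hsU : Set.Iio s ⊆ U) (ha : 0 < cdfLT μ X a) {T : Ω → ℝ} (hTm : Measurable T)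
    (hT : ∀ ω, (∀ i, X i ω ∈ U) → (∃ i, a ≤ X i ω) →
      a ≤ T ω ∧ T ω ≤ realizedMax fun i => X i ω) :
    allIn μ X U * a + cdfLT μ X a * (allIn μ X U * invInt (cdfLT μ X) a s - s)
      ≤ ∫ ω in {ω | ∀ i, X i ω ∈ U}, thrReward (fun i => X i ω) (T ω) ∂μ := by
  set F := cdfLT μ X with hF
  set G := allIn μ X U
  set E := {ω | ∀ i, X i ω ∈ U} with hE
  have hEm : MeasurableSet E := measurableSet_allIn hm hU
  have hρ := integrable_thrReward hm hi hTm
  let h : ℝ → ℝ := fun x => F a / F (max x a) * (G - F (max x a))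
  have hc1 : Set.EqOn (fun _ => G - F a) h (Set.uIoc 0 a) := by
    intro x hx
    rw [Set.uIoc_of_le ha0] at hx
    simp only [h, max_eq_right hx.2]
    field_simp
  have hc2 : Set.EqOn (fun x => F a * G * (F x)⁻¹ - F a) h (Set.uIoc a s) := by
    intro x hx
    rw [Set.uIoc_of_le has] at hx
    have hx0 : 0 < F x := ha.trans_le (cdfLT_mono hx.1.le)
    simp only [h, max_eq_left hx.1.le]
    field_simp
  have hi1 : IntervalIntegrable h volume 0 a :=
    (intervalIntegrable_const (c := G - F a)).congr hc1
  have hinv := intervalIntegrable_inv (cdfLT_mono (μ := μ) (X := X)) has ha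
  have hi2' : IntervalIntegrable (fun x => F a * G * (F x)⁻¹ - F a) volume a s :=
    (hinv.const_mul _).sub intervalIntegrable_const
  have hi2 : IntervalIntegrable h volume a s := hi2'.congr hc2
  have hint : ∫ x in (0 : ℝ)..s, h x = G * a + F a * (G * invInt F a s - s) := by
    rw [← intervalIntegral.integral_add_adjacent_intervals hi1 hi2,
      ← intervalIntegral.integral_congr_ae (.of_forall hc1),
      ← intervalIntegral.integral_congr_ae (.of_forall hc2),
      intervalIntegral.integral_sub (hinv.const_mul _) intervalIntegrable_const,
      intervalIntegral.integral_const_mul]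
    simp only [intervalIntegral.integral_const, smul_eq_mul, invInt]
    ring
  rw [← hint, ← integral_indicator hEm]
  refine intervalIntegral_le_integral_of_le_measureReal (hρ.indicator hEm)
    (ae_indicator_thrReward_nonneg h0 T E) (ha0.trans has) (hi1.trans hi2) fun x _ hxs => ?_
  exact cdfLT_div_mul_le_measureReal_indicator hm hindep hU le_rfl
    ((Set.Iio_subset_Iio (max_le hxs.le has)).trans hsU) ha (fun ω hω _ => hω)
    fun ω hω ⟨i, hi⟩ => hT ω hω ⟨i, (le_max_right x a).trans hi⟩

/-- Reward collected by a threshold that is at least `a` when the maximum is at least `y`. -/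
lemma le_setIntegral_sdiff_thrReward [IsProbabilityMeasure μ] [Nonempty (Fin n)]
    (hm : ∀ i, Measurable (X i))
    (hindep : iIndepFun X μ) (h0 : ∀ i, ∀ᵐ ω ∂μ, 0 ≤ X i ω) (hi : ∀ i, Integrable (X i) μ)
    {U : Set ℝ} (hU : MeasurableSet U) {a y : ℝ} (ha0 : 0 ≤ a) (hay : a ≤ y)
    (hyU : Set.Iio y ⊆ U) (ha : 0 < cdfLT μ X a) {T : Ω → ℝ} (hTm : Measurable T)
    (hT : ∀ ω, (∃ i, y ≤ X i ω) → a ≤ T ω ∧ T ω ≤ realizedMax fun i => X i ω) :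
    (a + cdfLT μ X a * invInt (cdfLT μ X) a y) * (allIn μ X U - cdfLT μ X y)
      ≤ ∫ ω in {ω | ∀ i, X i ω ∈ U} \ {ω | ∀ i, X i ω ∈ Set.Iio y},
          thrReward (fun i => X i ω) (T ω) ∂μ := by
  set F := cdfLT μ X with hF
  set G := allIn μ X U
  set E := {ω | ∀ i, X i ω ∈ U} \ {ω | ∀ i, X i ω ∈ Set.Iio y} with hE
  have hEm : MeasurableSet E :=
    (measurableSet_allIn hm hU).diff (measurableSet_allIn hm measurableSet_Iio)
  have hρ := integrable_thrReward hm hi hTm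
  let h : ℝ → ℝ := fun x => F a / F (max x a) * (G - F y)
  have hc1 : Set.EqOn (fun _ => G - F y) h (Set.uIoc 0 a) := by
    intro x hx
    rw [Set.uIoc_of_le ha0] at hx
    simp only [h, max_eq_right hx.2]
    field_simp
  have hc2 : Set.EqOn (fun x => F a * (G - F y) * (F x)⁻¹) h (Set.uIoc a y) := by
    intro x hx
    rw [Set.uIoc_of_le hay] at hx
    simp only [h, max_eq_left hx.1.le]
    ring
  have hi1 : IntervalIntegrable h volume 0 a :=
    (intervalIntegrable_const (c := G - F y)).congr hc1
  have hinv := intervalIntegrable_inv (cdfLT_mono (μ := μ) (X := X)) hay ha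
  have hi2 : IntervalIntegrable h volume a y := (hinv.const_mul _).congr hc2
  have hint : ∫ x in (0 : ℝ)..y, h x = (a + F a * invInt F a y) * (G - F y) := by
    rw [← intervalIntegral.integral_add_adjacent_intervals hi1 hi2,
      ← intervalIntegral.integral_congr_ae (.of_forall hc1),
      ← intervalIntegral.integral_congr_ae (.of_forall hc2),
      intervalIntegral.integral_const_mul]
    simp only [intervalIntegral.integral_const, smul_eq_mul, invInt]
    ring
  rw [← hint, ← integral_indicator hEm]
  refine intervalIntegral_le_integral_of_le_measureReal (hρ.indicator hEm)
    (ae_indicator_thrReward_nonneg h0 T E) (ha0.trans hay) (hi1.trans hi2) fun x _ hxy => ?_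
  exact cdfLT_div_mul_le_measureReal_indicator hm hindep hU (max_le hxy.le hay) hyU ha
    (fun ω hω ⟨i, hi⟩ => ⟨hω, fun h => absurd (h i) (not_lt.2 hi)⟩) fun ω _ h => hT ω h

/-- The degenerate case in which `1 / F` is unusable at `a`: almost surely some value reaches `a`,
so the algorithm always accepts. -/
lemma mul_le_setIntegral_thrReward [IsProbabilityMeasure μ] [Nonempty (Fin n)]
    (hm : ∀ i, Measurable (X i))
    (hi : ∀ i, Integrable (X i) μ)
    {U : Set ℝ} (hU : MeasurableSet U) {a : ℝ} (ha : cdfLT μ X a = 0) {T : Ω → ℝ}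
    (hTm : Measurable T)
    (hT : ∀ ω, (∀ i, X i ω ∈ U) → (∃ i, a ≤ X i ω) →
      a ≤ T ω ∧ T ω ≤ realizedMax fun i => X i ω) :
    allIn μ X U * a ≤ ∫ ω in {ω | ∀ i, X i ω ∈ U}, thrReward (fun i => X i ω) (T ω) ∂μ := by
  have hEm := measurableSet_allIn hm hU
  have e : allIn μ X U * a = ∫ ω in {ω | ∀ i, X i ω ∈ U}, a ∂μ := by
    rw [setIntegral_const, smul_eq_mul, allIn]
  rw [e]
  have hae : ∀ᵐ ω ∂μ, ∃ i, a ≤ X i ω := by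
    have : μ {ω | ∀ i, X i ω ∈ Set.Iio a} = 0 := (measureReal_eq_zero_iff).1 ha
    filter_upwards [measure_eq_zero_iff_ae_notMem.1 this] with ω hω
    by_contra hc
    push Not at hc
    exact hω hc
  refine setIntegral_mono_on_ae integrableOn_const (integrable_thrReward hm hi hTm).integrableOn
    hEm ?_
  filter_upwards [hae] with ω hω hωE
  have := hT ω hωE hω
  obtain ⟨i, hi, hi1, -⟩ := exists_thrReward_eq (le_realizedMax_iff.1 this.2)
  exact hi ▸ this.1.trans hi1

lemma setIntegral_realizedMax_le [IsProbabilityMeasure μ] [Nonempty (Fin n)]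
    (hm : ∀ i, Measurable (X i))
    (h0 : ∀ i, ∀ᵐ ω ∂μ, 0 ≤ X i ω) (hi : ∀ i, Integrable (X i) μ) {t : ℝ} (ht : 0 ≤ t) :
    ∫ ω in {ω | ∀ i, X i ω ∈ Set.Iio t}, realizedMax (fun i => X i ω) ∂μ
      ≤ t * cdfLT μ X t - ∫ x in (0 : ℝ)..t, cdfLT μ X x := by
  have hEm := measurableSet_allIn hm (measurableSet_Iio (a := t))
  have hF : IntervalIntegrable (cdfLT μ X) volume 0 t := cdfLT_mono.intervalIntegrable
  have e : t * cdfLT μ X t - ∫ x in (0 : ℝ)..t, cdfLT μ X x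
      = ∫ x in (0 : ℝ)..t, (cdfLT μ X t - cdfLT μ X x) := by
    rw [intervalIntegral.integral_sub intervalIntegrable_const hF]; simp
  rw [e, ← integral_indicator hEm]
  refine integral_le_intervalIntegral_of_measureReal_le
    ((integrable_realizedMax hm hi).indicator hEm) ?_ ht ?_ (intervalIntegrable_const.sub hF) ?_
  · filter_upwards [ae_all_iff.2 h0] with ω hω
    exact Set.indicator_apply_nonneg fun _ => realizedMax_nonneg hω
  · refine Filter.Eventually.of_forall fun ω => Set.indicator_le' (fun ω hω => ?_) (fun _ _ => ht) ω
    exact (realizedMax_lt_iff.2 hω).le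
  · intro x hx hxt
    have hsub : {ω | ∀ i, X i ω ∈ Set.Iio x} ⊆ {ω | ∀ i, X i ω ∈ Set.Iio t} :=
      fun ω hω i => (hω i).trans hxt
    refine le_of_le_of_eq (measureReal_mono ?_)
      (measureReal_sdiff hsub (measurableSet_allIn hm measurableSet_Iio))
    intro ω hω
    rw [Set.mem_ofPred_eq] at hω
    by_cases hE : ω ∈ {ω | ∀ i, X i ω ∈ Set.Iio t}
    · rw [Set.indicator_of_mem hE, le_realizedMax_iff] at hω
      obtain ⟨i, hi⟩ := hω
      exact ⟨hE, fun h => absurd (h i) (not_lt.2 hi)⟩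
    · rw [Set.indicator_of_notMem hE] at hω
      exact absurd hω (not_le.2 hx)

lemma setIntegral_sdiff_realizedMax_le [IsProbabilityMeasure μ] [Nonempty (Fin n)]
    (hm : ∀ i, Measurable (X i))
    (hi : ∀ i, Integrable (X i) μ) {v w : ℝ} (hvw : v ≤ w) :
    ∫ ω in {ω | ∀ i, X i ω ∈ Set.Iio w} \ {ω | ∀ i, X i ω ∈ Set.Iio v},
        realizedMax (fun i => X i ω) ∂μ
      ≤ w * (cdfLT μ X w - cdfLT μ X v) := by
  have hw := measurableSet_allIn hm (measurableSet_Iio (a := w))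
  have hv := measurableSet_allIn hm (measurableSet_Iio (a := v))
  have hsub : {ω | ∀ i, X i ω ∈ Set.Iio v} ⊆ {ω | ∀ i, X i ω ∈ Set.Iio w} :=
    fun ω hω i => lt_of_lt_of_le (hω i) hvw
  have e : w * (cdfLT μ X w - cdfLT μ X v)
      = ∫ ω in {ω | ∀ i, X i ω ∈ Set.Iio w} \ {ω | ∀ i, X i ω ∈ Set.Iio v}, w ∂μ := by
    rw [setIntegral_const, smul_eq_mul, measureReal_sdiff hsub hv, mul_comm]; rfl
  rw [e]
  refine setIntegral_mono_on (integrable_realizedMax hm hi).integrableOn integrableOn_const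
    (hw.diff hv) fun ω hω => ?_
  exact (realizedMax_lt_iff.2 hω.1).le

/-- The threshold used by the prediction-augmented algorithm. -/
def augThreshold (α : ℝ) (X : Fin n → Ω → ℝ) (τ : ℝ) (ω : Ω) : ℝ :=
  max τ (α * realizedMax fun i => X i ω)


lemma measurable_augThreshold (hm : ∀ i, Measurable (X i)) (α τ : ℝ) :
    Measurable (augThreshold α X τ) :=
  measurable_const.max ((measurable_realizedMax hm).const_mul α)

variable {α s : ℝ}

lemma le_setIntegral_augReward [IsProbabilityMeasure μ] [Nonempty (Fin n)] (hα0 : 0 < α)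
    (hα1 : α < 1)
    (hm : ∀ i, Measurable (X i)) (hindep : iIndepFun X μ) (h0 : ∀ i, ∀ᵐ ω ∂μ, 0 ≤ X i ω)
    (hi : ∀ i, Integrable (X i) μ) (hs : 0 ≤ s)
    (hs' : cdfLT μ X (α * s) = 0 ∨ s ≤ allIn μ X (Set.Iic s) * invInt (cdfLT μ X) (α * s) s) :
    allIn μ X (Set.Iic s) * (α * s)
      ≤ ∫ ω in {ω | ∀ i, X i ω ∈ Set.Iic s}, augReward α (fun i => X i ω) (α * s) ∂μ := by
  have hT : ∀ ω, (∀ i, X i ω ∈ Set.Iic s) → (∃ i, α * s ≤ X i ω) →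
      α * s ≤ augThreshold α X (α * s) ω ∧
        augThreshold α X (α * s) ω ≤ realizedMax fun i => X i ω := by
    intro ω hω hex
    refine ⟨le_max_left _ _, max_le (le_realizedMax_iff.2 hex) ?_⟩
    have h1 : α * realizedMax (fun i => X i ω) ≤ α * s := by
      have := realizedMax_le_iff.2 hω
      gcongr
    exact h1.trans (le_realizedMax_iff.2 hex)
  have hTm := measurable_augThreshold hm α (α * s)
  rcases (allIn_nonneg (μ := μ) (X := X) (Set.Iio (α * s))).eq_or_lt with h | h
  · exact mul_le_setIntegral_thrReward hm hi measurableSet_Iic h.symm hTm hT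
  · have h' : s ≤ allIn μ X (Set.Iic s) * invInt (cdfLT μ X) (α * s) s :=
      hs'.resolve_left h.ne'
    refine le_trans ?_ (le_setIntegral_thrReward hm hindep h0 hi measurableSet_Iic
      (mul_nonneg hα0.le hs) (by nlinarith) Set.Iio_subset_Iic_self h hTm hT)
    have := mul_nonneg h.le (sub_nonneg.2 h')
    exact le_add_of_nonneg_right this

lemma le_setIntegral_sdiff_augReward [IsProbabilityMeasure μ] [Nonempty (Fin n)] (hα0 : 0 < α)
    (hα1 : α < 1)
    (hm : ∀ i, Measurable (X i)) (hindep : iIndepFun X μ) (h0 : ∀ i, ∀ᵐ ω ∂μ, 0 ≤ X i ω)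
    (hi : ∀ i, Integrable (X i) μ) (hs : 0 ≤ s) {v w : ℝ} (hsv : s ≤ v) (hvw : v ≤ w)
    (hv : 0 < cdfLT μ X (α * v)) :
    (α * v + cdfLT μ X (α * v) * invInt (cdfLT μ X) (α * v) v) * (cdfLT μ X w - cdfLT μ X v)
      ≤ ∫ ω in {ω | ∀ i, X i ω ∈ Set.Iio w} \ {ω | ∀ i, X i ω ∈ Set.Iio v},
          augReward α (fun i => X i ω) (α * s) ∂μ := by
  have hv0 : 0 ≤ v := hs.trans hsv
  refine le_setIntegral_sdiff_thrReward hm hindep h0 hi measurableSet_Iio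
    (mul_nonneg hα0.le hv0) (by nlinarith) (Set.Iio_subset_Iio hvw) hv
    (measurable_augThreshold hm α (α * s)) fun ω hex => ?_
  have hM : v ≤ realizedMax fun i => X i ω := le_realizedMax_iff.2 hex
  have h1 : α * v ≤ α * realizedMax fun i => X i ω := by gcongr
  have h2 : α * s ≤ α * v := by gcongr
  have h3 : α * realizedMax (fun i => X i ω) ≤ realizedMax fun i => X i ω :=
    mul_le_of_le_one_left (hv0.trans hM) hα1.le
  exact ⟨h1.trans (le_max_right _ _), max_le ((h2.trans h1).trans h3) h3⟩

lemma integrable_augReward (hm : ∀ i, Measurable (X i)) (hi : ∀ i, Integrable (X i) μ) (τ : ℝ) :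
    Integrable (fun ω => augReward α (fun i => X i ω) τ) μ :=
  integrable_thrReward hm hi (measurable_augThreshold hm α τ)

/-- The initial term uses `(2 - α) α - 1 = -(1 - α)²`. The `δ` term pays for bounding the maximum in
each cell by its right end while the slope is taken at the left end. -/
lemma potential_le_setIntegral [IsProbabilityMeasure μ] [Nonempty (Fin n)] (hα0 : 0 < α)
    (hα1 : α < 1)
    (hm : ∀ i, Measurable (X i)) (hindep : iIndepFun X μ) (h0 : ∀ i, ∀ᵐ ω ∂μ, 0 ≤ X i ω)
    (hi : ∀ i, Integrable (X i) μ) (hs : 0 ≤ s)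
    (hpos : ∀ x, α * s < x → 0 < cdfLT μ X x)
    (hs' : cdfLT μ X (α * s) = 0 ∨ s ≤ allIn μ X (Set.Iic s) * invInt (cdfLT μ X) (α * s) s)
    {t δ : ℝ} (ht : s < t) (hδ : 0 ≤ δ) (K : ℕ) :
    (2 - α) * α * (s * allIn μ X (Set.Iic s) - t * cdfLT μ X t) + potential α (cdfLT μ X) t δ K
        - δ * (cdfLT μ X (t + K * δ) - cdfLT μ X t)
      ≤ (2 - α) * (∫ ω in {ω | ∀ i, X i ω ∈ Set.Iio (t + K * δ)},
            augReward α (fun i => X i ω) (α * s) ∂μ)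
        - ∫ ω in {ω | ∀ i, X i ω ∈ Set.Iio (t + K * δ)}, realizedMax (fun i => X i ω) ∂μ := by
  have h2α : 0 ≤ 2 - α := by linarith
  have hρ := integrable_augReward (α := α) hm hi (α * s)
  have hM := integrable_realizedMax hm hi
  induction K with
  | zero =>
    simp only [potential, Nat.cast_zero, zero_mul, add_zero, Finset.range_zero, Finset.sum_empty,
      sub_self, mul_zero, sub_zero]
    have h1 := le_setIntegral_augReward hα0 hα1 hm hindep h0 hi hs hs'
    have h2 := setIntegral_realizedMax_le hm h0 hi (hs.trans ht.le)
    have h3 : ∫ ω in {ω | ∀ i, X i ω ∈ Set.Iic s}, augReward α (fun i => X i ω) (α * s) ∂μ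
        ≤ ∫ ω in {ω | ∀ i, X i ω ∈ Set.Iio t}, augReward α (fun i => X i ω) (α * s) ∂μ :=
      setIntegral_mono_set hρ.integrableOn
        (ae_restrict_of_ae (ae_thrReward_nonneg h0 (augThreshold α X (α * s))))
        (Filter.Eventually.of_forall fun ω hω i => lt_of_le_of_lt (hω i) ht)
    have h4 := mul_le_mul_of_nonneg_left (h1.trans h3) h2α
    linarith
  | succ K ih =>
    have hKδ : 0 ≤ K * δ := by positivity
    have hs1 : potential α (cdfLT μ X) t δ (K + 1) = potential α (cdfLT μ X) t δ K
        + (cdfLT μ X (t + (K + 1) * δ) - cdfLT μ X (t + K * δ))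
          * slope α (cdfLT μ X) (t + K * δ) := by
      simp only [potential, Finset.sum_range_succ]; ring
    rw [hs1]
    push_cast
    set v := t + K * δ with hv
    set w := t + (K + 1) * δ with hw
    have hwv : w = v + δ := by rw [hw, hv]; ring
    have hvw : v ≤ w := by linarith
    have hsv : s < v := by linarith
    have hmv := measurableSet_allIn hm (measurableSet_Iio (a := v))
    have hmw := measurableSet_allIn hm (measurableSet_Iio (a := w))
    have hsub : {ω | ∀ i, X i ω ∈ Set.Iio v} ⊆ {ω | ∀ i, X i ω ∈ Set.Iio w} :=
      fun ω hω i => lt_of_lt_of_le (hω i) hvw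
    have hsplit : ∀ f : Ω → ℝ, Integrable f μ →
        ∫ ω in {ω | ∀ i, X i ω ∈ Set.Iio w}, f ω ∂μ
          = (∫ ω in {ω | ∀ i, X i ω ∈ Set.Iio v}, f ω ∂μ)
            + ∫ ω in {ω | ∀ i, X i ω ∈ Set.Iio w} \ {ω | ∀ i, X i ω ∈ Set.Iio v}, f ω ∂μ := by
      intro f hf
      rw [setIntegral_sdiff hmv hf.integrableOn hsub]
      ring
    have hr := le_setIntegral_sdiff_augReward hα0 hα1 hm hindep h0 hi hs hsv.le hvw
      (hpos _ (by gcongr))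
    have hx := setIntegral_sdiff_realizedMax_le (μ := μ) hm hi hvw
    rw [hsplit _ hρ, hsplit _ hM]
    have h4 := mul_le_mul_of_nonneg_left hr h2α
    have e : (cdfLT μ X w - cdfLT μ X v) * slope α (cdfLT μ X) v
        = (2 - α) * ((α * v + cdfLT μ X (α * v) * invInt (cdfLT μ X) (α * v) v)
          * (cdfLT μ X w - cdfLT μ X v)) - v * (cdfLT μ X w - cdfLT μ X v) := by
      unfold slope; ring
    have hx' : w * (cdfLT μ X w - cdfLT μ X v)
        = v * (cdfLT μ X w - cdfLT μ X v) + δ * (cdfLT μ X w - cdfLT μ X v) := by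
      rw [hwv]; ring
    linarith

lemma setIntegral_realizedMax_le_augTAL [IsProbabilityMeasure μ] [Nonempty (Fin n)] (hα0 : 0 < α)
    (hα1 : α < 1)
    (hm : ∀ i, Measurable (X i)) (hindep : iIndepFun X μ) (h0 : ∀ i, ∀ᵐ ω ∂μ, 0 ≤ X i ω)
    (hi : ∀ i, Integrable (X i) μ) (hs : 0 ≤ s)
    (hpos : ∀ x, α * s < x → 0 < cdfLT μ X x)
    (hJ : ∀ v, s < v → cdfLT μ X v * invInt (cdfLT μ X) (α * v) v ≤ v)
    (hs' : cdfLT μ X (α * s) = 0 ∨ s ≤ allIn μ X (Set.Iic s) * invInt (cdfLT μ X) (α * s) s)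
    {t e : ℝ} (ht : s < t) (hte : t ≤ e) :
    (∫ ω in {ω | ∀ i, X i ω ∈ Set.Iio e}, realizedMax (fun i => X i ω) ∂μ)
        + (2 - α) * α * (s * allIn μ X (Set.Iic s) - t * cdfLT μ X t)
      ≤ (2 - α) * augTAL μ α X (α * s) := by
  have h2α : 0 ≤ 2 - α := by linarith
  have hρ := integrable_augReward (α := α) hm hi (α * s)
  have hle : ∫ ω in {ω | ∀ i, X i ω ∈ Set.Iio e}, augReward α (fun i => X i ω) (α * s) ∂μ
      ≤ augTAL μ α X (α * s) :=
    setIntegral_le_integral hρ (ae_thrReward_nonneg h0 (augThreshold α X (α * s)))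
  -- The constant depends on `t` but not on the mesh, so refining the grid on `[t, e]` removes all
  -- errors.
  set C := 3 * (1 + α / cdfLT μ X (α * t)) + 1 with hC
  have hlim : Filter.Tendsto (fun N : ℕ => (2 - α) * augTAL μ α X (α * s)
      + C * ((e - t) * (1 / ((N : ℝ) + 1)))) Filter.atTop
      (nhds ((2 - α) * augTAL μ α X (α * s) + C * ((e - t) * 0))) :=
    ((tendsto_one_div_add_atTop_nhds_zero_nat.const_mul _).const_mul _).const_add _
  rw [mul_zero, mul_zero, add_zero] at hlim
  refine ge_of_tendsto' hlim fun N => ?_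
  set δ := (e - t) * (1 / ((N : ℝ) + 1)) with hδ
  have hN : (0 : ℝ) < (N : ℝ) + 1 := by positivity
  have hδ0 : 0 ≤ δ := mul_nonneg (by linarith) (by positivity)
  have heq : t + ((N + 1 : ℕ) : ℝ) * δ = e := by
    rw [hδ]; push_cast; field_simp; ring
  have h1 := potential_le_setIntegral hα0 hα1 hm hindep h0 hi hs hpos hs' ht hδ0 (N + 1)
  have h2 := potential_lower_bound (F := cdfLT μ X) cdfLT_mono (fun _ => allIn_nonneg _)
    (fun _ => allIn_le_one _) hα0 hα1 (hs.trans_lt ht) (hpos _ (by gcongr))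
    (fun v hv => hJ v (ht.trans_le hv)) hδ0 (N + 1)
  rw [heq] at h1
  have h3 : δ * (cdfLT μ X e - cdfLT μ X t) ≤ δ := by
    apply mul_le_of_le_one_right hδ0
    have a1 : cdfLT μ X e ≤ 1 := allIn_le_one _
    have a2 : 0 ≤ cdfLT μ X t := allIn_nonneg _
    linarith
  have h4 := mul_le_mul_of_nonneg_left hle h2α
  have h5 : C * δ = 3 * (1 + α / cdfLT μ X (α * t)) * δ + δ := by rw [hC]; ring
  linarith

lemma tendsto_allIn_Iio_of_gt [IsProbabilityMeasure μ] (hm : ∀ i, Measurable (X i)) (s : ℝ) :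
    Filter.Tendsto (fun m : ℕ => cdfLT μ X (s + 1 / ((m : ℝ) + 1))) Filter.atTop
      (nhds (allIn μ X (Set.Iic s))) := by
  have hanti : Antitone fun m : ℕ => {ω | ∀ i, X i ω ∈ Set.Iio (s + 1 / ((m : ℝ) + 1))} := by
    intro m k hmk ω hω i
    refine lt_of_lt_of_le (Set.mem_Iio.1 (hω i)) ?_
    have := Nat.one_div_le_one_div (α := ℝ) hmk
    linarith
  have h := tendsto_measure_iInter_atTop (μ := μ)
    (fun m => (measurableSet_allIn hm measurableSet_Iio).nullMeasurableSet) hanti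
    ⟨0, measure_ne_top _ _⟩
  have e : ⋂ m : ℕ, {ω | ∀ i, X i ω ∈ Set.Iio (s + 1 / ((m : ℝ) + 1))}
      = {ω | ∀ i, X i ω ∈ Set.Iic s} := by
    ext ω
    simp only [Set.mem_iInter, Set.mem_ofPred_eq]
    constructor
    · intro h i
      rw [Set.mem_Iic]
      refine le_of_forall_pos_lt_add fun ε hε => ?_
      obtain ⟨m, hm⟩ := exists_nat_one_div_lt hε
      exact (Set.mem_Iio.1 (h m i)).trans (by linarith)
    · intro h m i
      have : (0 : ℝ) < 1 / ((m : ℝ) + 1) := by positivity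
      exact lt_of_le_of_lt (Set.mem_Iic.1 (h i)) (by linarith)
  rw [e] at h
  exact (ENNReal.tendsto_toReal (measure_ne_top _ _)).comp h

/-- Sufficient conditions on a level `s` for the base threshold `α * s` to be good. -/
theorem OPT_le_augTAL [IsProbabilityMeasure μ] [Nonempty (Fin n)] (hα0 : 0 < α) (hα1 : α < 1)
    (hm : ∀ i, Measurable (X i)) (hindep : iIndepFun X μ) (h0 : ∀ i, ∀ᵐ ω ∂μ, 0 ≤ X i ω)
    (hi : ∀ i, Integrable (X i) μ) (hs : 0 ≤ s)
    (hpos : ∀ x, α * s < x → 0 < cdfLT μ X x)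
    (hJ : ∀ v, s < v → cdfLT μ X v * invInt (cdfLT μ X) (α * v) v ≤ v)
    (hs' : cdfLT μ X (α * s) = 0 ∨ s ≤ allIn μ X (Set.Iic s) * invInt (cdfLT μ X) (α * s) s) :
    1 / (2 - α) * OPT μ X ≤ augTAL μ α X (α * s) := by
  have h2α : 0 < 2 - α := by linarith
  rw [div_mul_eq_mul_div, one_mul, div_le_iff₀ h2α, mul_comm]
  have hM := integrable_realizedMax hm hi
  have hmono : Monotone fun m : ℕ => {ω | ∀ i, X i ω ∈ Set.Iio (s + 1 + (m : ℝ))} := by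
    intro m k hmk ω hω i
    refine lt_of_lt_of_le (Set.mem_Iio.1 (hω i)) ?_
    have : (m : ℝ) ≤ k := by exact_mod_cast hmk
    linarith
  have hU : ⋃ m : ℕ, {ω | ∀ i, X i ω ∈ Set.Iio (s + 1 + (m : ℝ))} = Set.univ := by
    rw [Set.eq_univ_iff_forall]
    intro ω
    obtain ⟨m, hm⟩ := exists_nat_gt (realizedMax fun i => X i ω)
    refine Set.mem_iUnion.2 ⟨m, fun i => ?_⟩
    have := le_realizedMax (fun i => X i ω) i
    exact lt_of_le_of_lt this (by linarith)
  have l1 := tendsto_setIntegral_of_monotone (μ := μ)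
    (fun m => measurableSet_allIn hm measurableSet_Iio) hmono hM.integrableOn
  rw [hU, setIntegral_univ] at l1
  -- The grid starts strictly above `s`, where balance and positivity of `F(α t)` are available. As
  -- `t` decreases to `s`, `F t` tends to `P(M ≤ s)`, which may exceed `F s`, and the boundary
  -- correction vanishes.
  have l2 : Filter.Tendsto (fun m : ℕ => (s + 1 / ((m : ℝ) + 1))
      * cdfLT μ X (s + 1 / ((m : ℝ) + 1))) Filter.atTop
      (nhds ((s + 0) * allIn μ X (Set.Iic s))) :=
    (tendsto_one_div_add_atTop_nhds_zero_nat.const_add s).mul (tendsto_allIn_Iio_of_gt hm s)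
  have l3 := l1.add ((l2.const_sub (s * allIn μ X (Set.Iic s))).const_mul ((2 - α) * α))
  rw [add_zero, sub_self, mul_zero, add_zero] at l3
  refine le_of_tendsto' l3 fun m => ?_
  have hm0 : (0 : ℝ) < 1 / ((m : ℝ) + 1) := by positivity
  have hm1 : 1 / ((m : ℝ) + 1) ≤ 1 := by
    rw [div_le_one (by positivity)]; linarith [(Nat.cast_nonneg m : (0 : ℝ) ≤ m)]
  exact setIntegral_realizedMax_le_augTAL hα0 hα1 hm hindep h0 hi hs hpos hJ hs'
    (by linarith) (by linarith [(Nat.cast_nonneg m : (0 : ℝ) ≤ m)])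

end Guarantee

/-! ### Existence of a balanced level for general instances. -/

section General

variable {Ω : Type*} [MeasurableSpace Ω] {μ : Measure Ω} {n : ℕ} {X : Fin n → Ω → ℝ}

/-- Left-continuity of `P(M < ·)`, which is why strict inequality is used in `cdfLT`. -/
lemma exists_lt_cdfLT_pos [Nonempty (Fin n)] {τ : ℝ} (h : 0 < cdfLT μ X τ) :
    ∃ b < τ, 0 < cdfLT μ X b := by
  by_contra! hc
  have hfin : μ {ω | ∀ i, X i ω ∈ Set.Iio τ} ≠ ⊤ := fun h' => by
    rw [cdfLT, allIn, measureReal_def, h', ENNReal.toReal_top] at h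
    exact h.false
  have hsub : ∀ b < τ, μ {ω | ∀ i, X i ω ∈ Set.Iio b} = 0 := fun b hb => by
    have hle : μ {ω | ∀ i, X i ω ∈ Set.Iio b} ≤ μ {ω | ∀ i, X i ω ∈ Set.Iio τ} :=
      measure_mono fun ω hω i => (hω i).trans hb
    exact (measureReal_eq_zero_iff (ne_top_of_le_ne_top hfin hle)).1
      (le_antisymm (hc b hb) (allIn_nonneg _))
  have hU : {ω | ∀ i, X i ω ∈ Set.Iio τ}
      ⊆ ⋃ m : ℕ, {ω | ∀ i, X i ω ∈ Set.Iio (τ - 1 / ((m : ℝ) + 1))} := by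
    intro ω hω
    have h1 : realizedMax (fun i => X i ω) < τ := realizedMax_lt_iff.2 hω
    obtain ⟨m, hm⟩ := exists_nat_one_div_lt (sub_pos.2 h1)
    exact Set.mem_iUnion.2 ⟨m, realizedMax_lt_iff.1 (by linarith)⟩
  have h0 : μ {ω | ∀ i, X i ω ∈ Set.Iio τ} = 0 :=
    measure_mono_null hU (measure_iUnion_null fun m => hsub _ (by
      have : (0 : ℝ) < 1 / ((m : ℝ) + 1) := by positivity
      linarith))
  rw [cdfLT, allIn, measureReal_def, h0, ENNReal.toReal_zero] at h
  exact h.false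

lemma cdfLT_eq_zero [Nonempty (Fin n)] (h0 : ∀ i, ∀ᵐ ω ∂μ, 0 ≤ X i ω) {x : ℝ} (hx : x ≤ 0) :
    cdfLT μ X x = 0 := by
  have : μ {ω | ∀ i, X i ω ∈ Set.Iio x} = 0 := by
    rw [measure_eq_zero_iff_ae_notMem]
    filter_upwards [ae_all_iff.2 h0] with ω hω h
    obtain ⟨i⟩ := ‹Nonempty (Fin n)›
    exact absurd ((Set.mem_Iio.1 (h i)).trans_le hx) (not_lt.2 (hω i))
  rw [cdfLT, allIn, measureReal_def, this, ENNReal.toReal_zero]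

/-- The balance condition at `τ` follows from the balance condition arbitrarily close to `τ`. -/
lemma balance_of_forall_lt [IsProbabilityMeasure μ] [Nonempty (Fin n)] {τ s G : ℝ}
    (hτs : τ ≤ s) (hG0 : 0 ≤ G) (hG1 : G ≤ 1)
    (h : ∀ b < τ, ∃ a, b < a ∧ a ≤ τ ∧ (cdfLT μ X a = 0 ∨ s ≤ G * invInt (cdfLT μ X) a s)) :
    cdfLT μ X τ = 0 ∨ s ≤ G * invInt (cdfLT μ X) τ s := by
  rcases (allIn_nonneg (μ := μ) (X := X) (Set.Iio τ)).eq_or_lt with h0 | h0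
  · exact Or.inl h0.symm
  right
  obtain ⟨b, hbτ, hb⟩ := exists_lt_cdfLT_pos h0
  refine le_of_forall_pos_le_add fun ε hε => ?_
  -- On `[a, τ]` the integrand is at most `1 / F b` and the length is at most `ε * F b`, so moving
  -- the endpoint from `a` to `τ` costs at most `ε`.
  obtain ⟨a, hba, haτ, ha⟩ := h (max b (τ - ε * cdfLT μ X b))
    (max_lt hbτ (by have := mul_pos hε hb; linarith))
  have hba' : b ≤ a := (le_max_left _ _).trans hba.le
  have hFa : 0 < cdfLT μ X a := hb.trans_le (cdfLT_mono hba')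
  have ha' := ha.resolve_left hFa.ne'
  rw [← invInt_add cdfLT_mono haτ hτs hFa] at ha'
  have h1 : invInt (cdfLT μ X) a τ ≤ ε := by
    refine (invInt_le cdfLT_mono haτ hFa).trans ?_
    rw [div_le_iff₀ hFa]
    have h2 := (le_max_right b (τ - ε * cdfLT μ X b)).trans hba.le
    have h3 := mul_le_mul_of_nonneg_left (cdfLT_mono (μ := μ) (X := X) hba') hε.le
    linarith
  have h4 : G * invInt (cdfLT μ X) a τ ≤ ε := by
    have := mul_le_mul_of_nonneg_left h1 hG0
    have := mul_le_mul_of_nonneg_right hG1 hε.le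
    linarith
  linarith

lemma exists_lt_cdfLT [IsProbabilityMeasure μ] [Nonempty (Fin n)] {c : ℝ} (hc : c < 1) :
    ∃ x, 0 ≤ x ∧ c < cdfLT μ X x := by
  have hmono : Monotone fun m : ℕ => {ω | ∀ i, X i ω ∈ Set.Iio (m : ℝ)} := by
    intro m k hmk ω hω i
    exact (Set.mem_Iio.1 (hω i)).trans_le (by exact_mod_cast hmk)
  have h := tendsto_measure_iUnion_atTop (μ := μ) hmono
  have hU : ⋃ m : ℕ, {ω | ∀ i, X i ω ∈ Set.Iio (m : ℝ)} = Set.univ := by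
    rw [Set.eq_univ_iff_forall]
    intro ω
    obtain ⟨m, hm⟩ := exists_nat_gt (realizedMax fun i => X i ω)
    exact Set.mem_iUnion.2 ⟨m, realizedMax_lt_iff.1 hm⟩
  rw [hU] at h
  have h' : Filter.Tendsto (fun m : ℕ => cdfLT μ X (m : ℝ)) Filter.atTop
      (nhds (μ.real Set.univ)) :=
    (ENNReal.tendsto_toReal (measure_ne_top _ _)).comp h
  rw [probReal_univ] at h'
  obtain ⟨m, hm⟩ := (h'.eventually (lt_mem_nhds hc)).exists
  exact ⟨m, Nat.cast_nonneg m, hm⟩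

lemma OPT_of_isEmpty [IsEmpty (Fin n)] : OPT μ X = 0 := by
  simp [OPT, realizedMax, Real.iSup_of_isEmpty]

lemma augTAL_nonneg (h0 : ∀ i, ∀ᵐ ω ∂μ, 0 ≤ X i ω) (α τ : ℝ) : 0 ≤ augTAL μ α X τ :=
  integral_nonneg_of_ae (ae_thrReward_nonneg h0 (augThreshold α X τ))

/-- Every instance has a base threshold with guarantee `1 / (2 - α)`. -/
theorem exists_OPT_le_augTAL [IsProbabilityMeasure μ] {α : ℝ} (hα0 : 0 < α) (hα1 : α < 1)
    (hm : ∀ i, Measurable (X i)) (hindep : iIndepFun X μ) (h0 : ∀ i, ∀ᵐ ω ∂μ, 0 ≤ X i ω)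
    (hi : ∀ i, Integrable (X i) μ) :
    ∃ τ : ℝ, 0 ≤ τ ∧ 1 / (2 - α) * OPT μ X ≤ augTAL μ α X τ := by
  rcases isEmpty_or_nonempty (Fin n) with hn | hn
  · exact ⟨0, le_rfl, by rw [OPT_of_isEmpty, mul_zero]; exact augTAL_nonneg h0 α 0⟩
  set F := cdfLT μ X with hF
  have hFm : Monotone F := cdfLT_mono
  have hF0 : ∀ x, 0 ≤ F x := fun x => allIn_nonneg _
  let B : Set ℝ := {v | 0 ≤ v ∧ (F (α * v) = 0 ∨ v < F v * invInt F (α * v) v)}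
  have h0B : (0 : ℝ) ∈ B := ⟨le_rfl, Or.inl (cdfLT_eq_zero h0 (by simp))⟩
  have hBbdd : BddAbove B := by
    -- Once `F(α v) > 1 - α`, one has `F(v) J(v) ≤ (1 - α) v / F(α v) ≤ v`, so `v` cannot lie in
    -- `B`.
    obtain ⟨x, hx0, hx⟩ := exists_lt_cdfLT (μ := μ) (X := X) (show 1 - α < 1 by linarith)
    refine ⟨x / α, fun v hv => ?_⟩
    by_contra! hlt
    rw [div_lt_iff₀ hα0] at hlt
    have hFv : 1 - α < F (α * v) := hx.trans_le (hFm (by linarith))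
    have hpos : 0 < F (α * v) := by linarith
    rcases hv.2 with h | h
    · exact hpos.ne' h
    · refine absurd h (not_lt.2 ?_)
      have hαv : α * v ≤ v := by nlinarith [hv.1]
      have h1 : 0 ≤ invInt F (α * v) v :=
        intervalIntegral.integral_nonneg hαv fun x _ => inv_nonneg.2 (hF0 x)
      refine (mul_le_of_le_one_left h1 (allIn_le_one _)).trans ?_
      refine (invInt_le hFm hαv hpos).trans ?_
      rw [div_le_iff₀ hpos]
      nlinarith [hv.1]
  set s := sSup B with hs
  have hs0 : 0 ≤ s := le_csSup hBbdd h0B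
  have hnot : ∀ v, s < v → 0 < F (α * v) ∧ F v * invInt F (α * v) v ≤ v := by
    intro v hv
    have hvB : v ∉ B := notMem_of_csSup_lt hv hBbdd
    have h1 : ¬(F (α * v) = 0 ∨ v < F v * invInt F (α * v) v) := fun h =>
      hvB ⟨hs0.trans hv.le, h⟩
    push Not at h1
    exact ⟨(hF0 _).lt_of_ne' h1.1, h1.2⟩
  refine ⟨α * s, by positivity, OPT_le_augTAL hα0 hα1 hm hindep h0 hi hs0 (fun x hx => ?_)
    (fun v hv => (hnot v hv).2) ?_⟩
  · have := (hnot (x / α) (by rwa [lt_div_iff₀ hα0, mul_comm])).1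
    rwa [mul_div_cancel₀ _ hα0.ne'] at this
  · refine balance_of_forall_lt (by nlinarith) (allIn_nonneg _) (allIn_le_one _) fun b hb => ?_
    obtain ⟨v, hvB, hbv⟩ := exists_lt_of_lt_csSup ⟨0, h0B⟩
      (show b / α < s by rwa [div_lt_iff₀ hα0, mul_comm])
    have hvs : v ≤ s := le_csSup hBbdd hvB
    refine ⟨α * v, by rwa [div_lt_iff₀ hα0, mul_comm] at hbv, by gcongr, ?_⟩
    rcases (hF0 (α * v)).eq_or_lt with hz | hz
    · exact Or.inl hz.symm
    right
    have hv := hvB.2.resolve_left hz.ne'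
    have hαv : α * v ≤ v := by nlinarith [hvB.1]
    have hFs : 0 < F s := hz.trans_le (hFm (hαv.trans hvs))
    have hFv : 0 < F v := hz.trans_le (hFm hαv)
    have hFG : F s ≤ allIn μ X (Set.Iic s) := allIn_mono Set.Iio_subset_Iic_self
    -- The piece over `[α v, v]` contributes at least `v` because `v ∈ B`; the piece over `[v, s]`
    -- contributes at least `s - v`, since `1 / F ≥ 1 / F s` there.
    rw [← hF, ← invInt_add hFm hαv hvs hz, mul_add]
    have h1 : 0 ≤ invInt F (α * v) v :=
      intervalIntegral.integral_nonneg hαv fun x _ => inv_nonneg.2 (hF0 x)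
    have h2 : 0 ≤ invInt F v s :=
      intervalIntegral.integral_nonneg hvs fun x _ => inv_nonneg.2 (hF0 x)
    have h3 := mul_le_mul_of_nonneg_right ((hFm hvs).trans hFG) h1
    have h4 := mul_le_mul_of_nonneg_right hFG h2
    have h5 := le_invInt hFm hvs hFv
    rw [div_le_iff₀ hFs] at h5
    linarith

end General

/-! ### The SC-threshold and its integral consequences. -/

section SCThreshold

variable {Ω : Type*} [MeasurableSpace Ω] {μ : Measure Ω} {n : ℕ} {X : Fin n → Ω → ℝ} {τ : ℝ}

lemma TAL_le_OPT [Nonempty (Fin n)] (hm : ∀ i, Measurable (X i))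
    (h0 : ∀ i, ∀ᵐ ω ∂μ, 0 ≤ X i ω) (hi : ∀ i, Integrable (X i) μ) : TAL μ X τ ≤ OPT μ X := by
  refine integral_mono_ae (integrable_thrReward hm hi measurable_const)
    (integrable_realizedMax hm hi) ?_
  filter_upwards [ae_all_iff.2 h0] with ω hω using thrReward_le_realizedMax hω

lemma TAL_nonneg (h0 : ∀ i, ∀ᵐ ω ∂μ, 0 ≤ X i ω) : 0 ≤ TAL μ X τ :=
  integral_nonneg_of_ae (ae_thrReward_nonneg h0 fun _ => τ)

lemma scThreshold_nonneg : 0 ≤ scThreshold μ X := Real.sSup_nonneg fun _ h => h.1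

lemma le_scThreshold [Nonempty (Fin n)] (hm : ∀ i, Measurable (X i))
    (h0 : ∀ i, ∀ᵐ ω ∂μ, 0 ≤ X i ω) (hi : ∀ i, Integrable (X i) μ) (hτ : 0 ≤ τ)
    (h : τ ≤ TAL μ X τ) : τ ≤ scThreshold μ X :=
  le_csSup ⟨OPT μ X, fun _ h => h.2.trans (TAL_le_OPT hm h0 hi)⟩ ⟨hτ, h⟩

lemma TAL_lt_of_scThreshold_lt [Nonempty (Fin n)] (hm : ∀ i, Measurable (X i))
    (h0 : ∀ i, ∀ᵐ ω ∂μ, 0 ≤ X i ω) (hi : ∀ i, Integrable (X i) μ)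
    (h : scThreshold μ X < τ) : TAL μ X τ < τ := by
  by_contra! hc
  exact (le_scThreshold hm h0 hi (scThreshold_nonneg.trans h.le) hc).not_gt h

lemma exists_le_TAL_of_lt_scThreshold (h0 : ∀ i, ∀ᵐ ω ∂μ, 0 ≤ X i ω) {b : ℝ}
    (hb : b < scThreshold μ X) : ∃ a, b < a ∧ a ≤ TAL μ X a := by
  obtain ⟨a, ha, hba⟩ := exists_lt_of_lt_csSup (s := {τ : ℝ | 0 ≤ τ ∧ τ ≤ TAL μ X τ})
    ⟨0, le_rfl, TAL_nonneg h0⟩ hb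
  exact ⟨a, hba, ha.2⟩

lemma le_TAL_of_cdfLT_eq_zero [IsProbabilityMeasure μ] [Nonempty (Fin n)]
    (hm : ∀ i, Measurable (X i)) (hi : ∀ i, Integrable (X i) μ) (h : cdfLT μ X τ = 0) :
    τ ≤ TAL μ X τ := by
  have := mul_le_setIntegral_thrReward hm hi MeasurableSet.univ h
    (measurable_const (a := τ)) fun ω _ hex => ⟨le_rfl, le_realizedMax_iff.2 hex⟩
  simpa [allIn, TAL] using this

/-- The reward bound `le_setIntegral_thrReward` with no restriction on the values, read backwards:
too large an integral would force `TAL ≥ τ`. -/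
lemma invInt_le_of_TAL_lt [IsProbabilityMeasure μ] [Nonempty (Fin n)]
    (hm : ∀ i, Measurable (X i)) (hindep : iIndepFun X μ) (h0 : ∀ i, ∀ᵐ ω ∂μ, 0 ≤ X i ω)
    (hi : ∀ i, Integrable (X i) μ) {w : ℝ} (hτ : 0 ≤ τ) (hτw : τ ≤ w) (h : TAL μ X τ < τ) :
    invInt (cdfLT μ X) τ w ≤ w := by
  have hpos : 0 < cdfLT μ X τ := by
    refine (allIn_nonneg _).lt_of_ne fun h' => ?_
    exact (le_TAL_of_cdfLT_eq_zero hm hi h'.symm).not_gt h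
  have h1 := le_setIntegral_thrReward hm hindep h0 hi MeasurableSet.univ hτ hτw
    (Set.subset_univ _) hpos (measurable_const (a := τ))
    fun ω _ hex => ⟨le_rfl, le_realizedMax_iff.2 hex⟩
  have h2 : τ + cdfLT μ X τ * (invInt (cdfLT μ X) τ w - w) ≤ TAL μ X τ := by
    simpa [allIn, TAL] using h1
  by_contra! hc
  have := mul_pos hpos (sub_pos.2 hc)
  linarith

lemma invInt_eq_of_eq_mul {F H : ℝ → ℝ} {a b Q : ℝ} (hab : a ≤ b)
    (h : ∀ x, a < x → x ≤ b → F x = H x * Q) : invInt F a b = Q⁻¹ * invInt H a b := by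
  rw [invInt, invInt, ← intervalIntegral.integral_const_mul]
  refine intervalIntegral.integral_congr_ae (.of_forall fun x hx => ?_)
  rw [Set.uIoc_of_le hab] at hx
  rw [h x hx.1 hx.2, mul_inv, mul_comm]

end SCThreshold

/-! ### Prefixes of an instance. -/

section Prefix

variable {Ω : Type*} [MeasurableSpace Ω] {μ : Measure Ω} {n : ℕ} {X : Fin n → Ω → ℝ}

lemma iIndepFun_prefixThrough (h : iIndepFun X μ) (k : Fin n) :
    iIndepFun (prefixThrough X k) μ :=
  iIndepFun.precomp (g := Fin.castLE k.isLt) (Fin.castLE_injective _) h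

lemma thrReward_castLE_le {m : ℕ} (hmn : m ≤ n) {R : Fin n → ℝ} (hR : ∀ i, 0 ≤ R i) (τ : ℝ) :
    thrReward (fun i => R (Fin.castLE hmn i)) τ ≤ thrReward R τ := by
  by_cases h : ∃ i : Fin m, τ ≤ R (Fin.castLE hmn i)
  · obtain ⟨i, hi, hi1, hi2⟩ := exists_thrReward_eq h
    rw [hi, thrReward_of_first hi1]
    intro j hj
    exact hi2 ⟨j, (Fin.lt_def.1 hj).trans i.2⟩ hj
  · rw [thrReward_of_not_exists h]
    exact thrReward_nonneg hR

lemma scThreshold_prefixThrough_mono (hm : ∀ i, Measurable (X i))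
    (h0 : ∀ i, ∀ᵐ ω ∂μ, 0 ≤ X i ω) (hi : ∀ i, Integrable (X i) μ) {j k : Fin n} (hjk : j ≤ k) :
    scThreshold μ (prefixThrough X j) ≤ scThreshold μ (prefixThrough X k) := by
  refine csSup_le ⟨0, le_rfl, TAL_nonneg fun _ => h0 _⟩ fun τ hτ => ?_
  refine le_scThreshold (fun _ => hm _) (fun _ => h0 _) (fun _ => hi _) hτ.1 (hτ.2.trans ?_)
  refine integral_mono_ae (integrable_thrReward (fun _ => hm _) (fun _ => hi _) measurable_const)
    (integrable_thrReward (fun _ => hm _) (fun _ => hi _) measurable_const) ?_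
  filter_upwards [ae_all_iff.2 h0] with ω hω
  exact thrReward_castLE_le (Nat.succ_le_succ hjk) (R := fun i => prefixThrough X k i ω)
    (fun _ => hω _) τ

lemma allIn_eq_prefixThrough_mul (hindep : iIndepFun X μ) {U : Set ℝ} (hU : MeasurableSet U)
    (k : Fin n) :
    allIn μ X U = allIn μ (prefixThrough X k) U * ∏ i with k < i, μ.real (X i ⁻¹' U) := by
  rw [allIn_eq_prod hindep hU, allIn_eq_prod (iIndepFun_prefixThrough hindep k) hU,
    ← Finset.prod_filter_mul_prod_filter_not Finset.univ (fun i => i ≤ k)]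
  simp only [not_le]
  congr 1
  symm
  refine Finset.prod_nbij (fun i => Fin.castLE k.isLt i) (fun i _ => ?_)
    (Fin.castLE_injective _).injOn (fun i hi => ?_) (fun i _ => rfl)
  · simp only [Finset.mem_filter, Finset.mem_univ, true_and]
    exact Fin.le_def.2 (Nat.lt_succ_iff.1 i.2)
  · simp only [Finset.coe_filter, Finset.mem_univ, true_and, Set.mem_ofPred_eq] at hi
    exact ⟨⟨i, Nat.lt_succ_iff.2 hi⟩, by simp, rfl⟩

end Prefix

/-! ### Sorted scaled Bernoulli instances. -/

section Bernoulli

variable {Ω : Type*} [MeasurableSpace Ω] {μ : Measure Ω} {n : ℕ} {X : Fin n → Ω → ℝ}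
  {v : Fin n → ℝ}

namespace IsSortedScaledBernoulli

lemma ae_nonneg (hX : IsSortedScaledBernoulli μ X v) (i : Fin n) : ∀ᵐ ω ∂μ, 0 ≤ X i ω := by
  filter_upwards [hX.supported i] with ω hω
  rcases hω with h | h
  · exact h.ge
  · exact h ▸ hX.nonneg i

lemma ae_le (hX : IsSortedScaledBernoulli μ X v) (i : Fin n) : ∀ᵐ ω ∂μ, X i ω ≤ v i := by
  filter_upwards [hX.supported i] with ω hω
  rcases hω with h | h
  · exact h ▸ hX.nonneg i
  · exact h.le

lemma integrable [IsProbabilityMeasure μ] (hX : IsSortedScaledBernoulli μ X v)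
    (hm : ∀ i, Measurable (X i)) (i : Fin n) : Integrable (X i) μ := by
  refine Integrable.of_bound (hm i).aestronglyMeasurable (v i) ?_
  filter_upwards [hX.ae_nonneg i, hX.ae_le i] with ω h1 h2
  rwa [Real.norm_of_nonneg h1]

lemma prefixThrough (hX : IsSortedScaledBernoulli μ X v) (k : Fin n) :
    IsSortedScaledBernoulli μ (prefixThrough X k) fun i => v (Fin.castLE k.isLt i) where
  nonneg _ := hX.nonneg _
  sorted _ _ h := hX.sorted h
  supported _ := hX.supported _

lemma measureReal_preimage_of_notMem (hX : IsSortedScaledBernoulli μ X v) {U : Set ℝ}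
    (h0 : (0 : ℝ) ∈ U) {i : Fin n} (hv : v i ∉ U) :
    μ.real (X i ⁻¹' U) = μ.real (X i ⁻¹' {0}) := by
  refine measureReal_congr ?_
  filter_upwards [hX.supported i] with ω hω
  refine propext ⟨fun h => ?_, fun h => ?_⟩
  · rcases hω with h' | h'
    · exact h'
    · exact absurd (h' ▸ h : v i ∈ U) hv
  · have h' : X i ω = 0 := h
    exact (h' ▸ h0 : X i ω ∈ U)

lemma measureReal_preimage_of_mem [IsProbabilityMeasure μ] (hX : IsSortedScaledBernoulli μ X v)
    {U : Set ℝ} (h0 : (0 : ℝ) ∈ U) {i : Fin n} (hv : v i ∈ U) : μ.real (X i ⁻¹' U) = 1 := by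
  rw [← probReal_univ (μ := μ)]
  refine measureReal_congr ?_
  filter_upwards [hX.supported i] with ω hω
  refine propext ⟨fun _ => trivial, fun _ => ?_⟩
  change X i ω ∈ U
  rcases hω with h | h <;> rw [h] <;> assumption

/-- The converse of the general reward bound. Since values arrive in increasing order, a first
accepted value of at least `x` forces every value out of `[a, x)`. Positivity of `a` keeps zeros
from being accepted. -/
lemma TAL_le [IsProbabilityMeasure μ] [Nonempty (Fin n)] (hX : IsSortedScaledBernoulli μ X v)
    (hm : ∀ i, Measurable (X i)) (hindep : iIndepFun X μ) {a s : ℝ} (ha0 : 0 < a) (has : a ≤ s)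
    (hvs : ∀ i, v i ≤ s) (ha : 0 < cdfLT μ X a) :
    TAL μ X a ≤ a + cdfLT μ X a * (invInt (cdfLT μ X) a s - s) := by
  set F := cdfLT μ X with hF
  let h : ℝ → ℝ := fun x => F a / F (max x a) - F a
  have hc1 : Set.EqOn (fun _ => 1 - F a) h (Set.uIoc 0 a) := by
    intro x hx
    rw [Set.uIoc_of_le ha0.le] at hx
    simp only [h, max_eq_right hx.2, div_self ha.ne']
  have hc2 : Set.EqOn (fun x => F a * (F x)⁻¹ - F a) h (Set.uIoc a s) := by
    intro x hx
    rw [Set.uIoc_of_le has] at hx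
    simp only [h, max_eq_left hx.1.le, div_eq_mul_inv]
  have hi1 : IntervalIntegrable h volume 0 a :=
    (intervalIntegrable_const (c := 1 - F a)).congr hc1
  have hinv := intervalIntegrable_inv (cdfLT_mono (μ := μ) (X := X)) has ha
  have hi2' : IntervalIntegrable (fun x => F a * (F x)⁻¹ - F a) volume a s :=
    (hinv.const_mul _).sub intervalIntegrable_const
  have hi2 : IntervalIntegrable h volume a s := hi2'.congr hc2
  have hint : ∫ x in (0 : ℝ)..s, h x = a + F a * (invInt F a s - s) := by
    rw [← intervalIntegral.integral_add_adjacent_intervals hi1 hi2,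
      ← intervalIntegral.integral_congr_ae (.of_forall hc1),
      ← intervalIntegral.integral_congr_ae (.of_forall hc2),
      intervalIntegral.integral_sub (hinv.const_mul _) intervalIntegrable_const,
      intervalIntegral.integral_const_mul]
    simp only [intervalIntegral.integral_const, smul_eq_mul, invInt]
    ring
  rw [← hint]
  have h0 := ae_all_iff.2 hX.ae_nonneg
  refine integral_le_intervalIntegral_of_measureReal_le
    (integrable_thrReward hm (hX.integrable hm) measurable_const)
    (ae_thrReward_nonneg hX.ae_nonneg fun _ => a) (ha0.le.trans has) ?_ (hi1.trans hi2) ?_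
  · filter_upwards [h0, ae_all_iff.2 hX.ae_le] with ω h1 h2
    exact (thrReward_le_realizedMax h1).trans
      (realizedMax_le_iff.2 fun i => (h2 i).trans (hvs i))
  intro x hx0 hxs
  set y := max x a with hy
  have hay : a ≤ y := le_max_right _ _
  have hFy : 0 < F y := ha.trans_le (cdfLT_mono hay)
  have hmy : MeasurableSet (Set.Ico a y)ᶜ := measurableSet_Ico.compl
  -- Equality holds coordinatewise: `v i` lies below `a`, in `[a, y)`, or at least at `y`, and in
  -- each case two of the three probabilities agree while the third is one.
  have hprod : allIn μ X (Set.Ico a y)ᶜ = F a / F y := by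
    rw [eq_div_iff hFy.ne', hF, cdfLT, cdfLT, allIn_eq_prod hindep hmy,
      allIn_eq_prod hindep measurableSet_Iio, allIn_eq_prod hindep measurableSet_Iio,
      ← Finset.prod_mul_distrib]
    refine Finset.prod_congr rfl fun i _ => ?_
    have z1 : (0 : ℝ) ∈ (Set.Ico a y)ᶜ := fun h => absurd h.1 (not_le.2 ha0)
    have z2 : (0 : ℝ) ∈ Set.Iio y := ha0.trans_le hay
    have z3 : (0 : ℝ) ∈ Set.Iio a := ha0
    rcases lt_or_ge (v i) a with h1 | h1
    · rw [hX.measureReal_preimage_of_mem z1 (fun h => absurd h.1 (not_le.2 h1)),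
        hX.measureReal_preimage_of_mem z2 (h1.trans_le hay),
        hX.measureReal_preimage_of_mem z3 h1, mul_one]
    rcases lt_or_ge (v i) y with h2 | h2
    · rw [hX.measureReal_preimage_of_notMem z1 (fun h => h ⟨h1, h2⟩),
        hX.measureReal_preimage_of_mem z2 h2,
        hX.measureReal_preimage_of_notMem z3 (not_lt.2 h1), mul_one]
    · rw [hX.measureReal_preimage_of_mem z1 (fun h => absurd h.2 (not_lt.2 h2)),
        hX.measureReal_preimage_of_notMem z2 (not_lt.2 h2),
        hX.measureReal_preimage_of_notMem z3 (not_lt.2 h1), one_mul]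
  have hsub : {ω | ∀ i, X i ω ∈ Set.Iio a} ⊆ {ω | ∀ i, X i ω ∈ (Set.Ico a y)ᶜ} :=
    fun ω hω i h => absurd (hω i) (not_lt.2 h.1)
  have hmeas : μ.real ({ω | ∀ i, X i ω ∈ (Set.Ico a y)ᶜ} \ {ω | ∀ i, X i ω ∈ Set.Iio a})
      = F a / F y - F a := by
    rw [measureReal_sdiff hsub (measurableSet_allIn hm measurableSet_Iio), ← hprod]; rfl
  change _ ≤ F a / F y - F a
  rw [← hmeas]
  refine ENNReal.toReal_mono (measure_ne_top _ _) (measure_mono_ae ?_)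
  filter_upwards [ae_all_iff.2 hX.supported] with ω hsupp hω
  have hω' : x ≤ thrReward (fun i => X i ω) a := hω
  have hex : ∃ i, a ≤ X i ω := by
    by_contra hc
    rw [thrReward_of_not_exists hc] at hω'
    exact absurd hω' (not_le.2 hx0)
  obtain ⟨i, hi, hi1, hi2⟩ := exists_thrReward_eq hex
  have hiy : y ≤ X i ω := max_le (hi ▸ hω') hi1
  have hiv : X i ω = v i := (hsupp i).resolve_left (ha0.trans_le hi1).ne'
  refine ⟨fun j hj => ?_, fun h => absurd (h i) (not_lt.2 hi1)⟩
  rcases lt_trichotomy j i with hji | rfl | hji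
  · exact absurd (hi2 j hji) (not_lt.2 hj.1)
  · exact absurd hj.2 (not_lt.2 hiy)
  · rcases hsupp j with h | h
    · exact absurd hj.1 (by rw [h]; exact not_le.2 ha0)
    · have : v i ≤ v j := hX.sorted hji.le
      exact absurd hj.2 (not_lt.2 (by rw [h]; linarith))

/-- A variable that is almost surely positive pushes the SC-threshold up to its value. -/
lemma le_scThreshold_of_measureReal_eq_zero [IsProbabilityMeasure μ]
    (hX : IsSortedScaledBernoulli μ X v) (hm : ∀ i, Measurable (X i)) {i k : Fin n} (hik : i ≤ k)
    (hv : 0 < v i) (h : μ.real (X i ⁻¹' {0}) = 0) :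
    v i ≤ scThreshold μ (Prophet.prefixThrough X k) := by
  refine le_scThreshold (fun _ => hm _) (hX.prefixThrough k).ae_nonneg
    (fun _ => hX.integrable hm _) hv.le (le_TAL_of_cdfLT_eq_zero (fun _ => hm _)
      (fun _ => hX.integrable hm _) (le_antisymm ?_ (allIn_nonneg _)))
  rw [← h, ← hX.measureReal_preimage_of_notMem (U := Set.Iio (v i)) hv
    (lt_irrefl (v i))]
  exact measureReal_mono fun ω hω => hω ⟨i, Nat.lt_succ_iff.2 hik⟩

end IsSortedScaledBernoulli

lemma mem_goodPrefixes {α : ℝ} {k : Fin n} :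
    k ∈ goodPrefixes μ α X v ↔ α * v k ≤ scThreshold μ (prefixThrough X k) := by
  simp [goodPrefixes]

lemma tauStar_nonneg (α : ℝ) : 0 ≤ tauStar μ α X v := by
  unfold tauStar
  split_ifs
  exacts [scThreshold_nonneg, le_rfl]

/-- Either no prefix is good and `tauStar` vanishes, or it is attained at the last good prefix. -/
lemma tauStar_cases (α : ℝ) :
    ((∀ j, scThreshold μ (prefixThrough X j) < α * v j) ∧ tauStar μ α X v = 0) ∨
    ∃ k, tauStar μ α X v = scThreshold μ (prefixThrough X k) ∧
      α * v k ≤ scThreshold μ (prefixThrough X k) ∧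
      ∀ j, k < j → scThreshold μ (prefixThrough X j) < α * v j := by
  by_cases h : (goodPrefixes μ α X v).Nonempty
  · right
    refine ⟨(goodPrefixes μ α X v).max' h, by rw [tauStar, dif_pos h],
      mem_goodPrefixes.1 (Finset.max'_mem _ h), fun j hj => ?_⟩
    by_contra! hc
    exact hj.not_ge (Finset.le_max' _ _ (mem_goodPrefixes.2 hc))
  · left
    refine ⟨fun j => ?_, by rw [tauStar, dif_neg h]⟩
    by_contra! hc
    exact h ⟨j, mem_goodPrefixes.2 hc⟩

/-- The guarantee of `tauStar` on sorted scaled Bernoulli instances. -/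
theorem IsSortedScaledBernoulli.OPT_le_augTAL_tauStar [IsProbabilityMeasure μ] {α : ℝ}
    (hα0 : 0 < α) (hα1 : α < 1) (hX : IsSortedScaledBernoulli μ X v)
    (hm : ∀ i, Measurable (X i)) (hindep : iIndepFun X μ) :
    1 / (2 - α) * OPT μ X ≤ augTAL μ α X (tauStar μ α X v) := by
  have h0 := hX.ae_nonneg
  have hi := hX.integrable hm
  rcases isEmpty_or_nonempty (Fin n) with hn | hn
  · rw [OPT_of_isEmpty, mul_zero]; exact augTAL_nonneg h0 α _
  set τ := tauStar μ α X v with hτ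
  have hτ0 : 0 ≤ τ := tauStar_nonneg α
  set s := τ / α with hs
  have hs0 : 0 ≤ s := by positivity
  have hαs : α * s = τ := by rw [hs]; field_simp
  have hcases := tauStar_cases (μ := μ) (X := X) (v := v) α
  rw [← hτ] at hcases
  -- An almost surely positive `X i` would make `i` a good prefix and push `τ` up to at least `v i`.
  have hq : ∀ i, τ < v i → 0 < μ.real (X i ⁻¹' {0}) := by
    intro i hiv
    refine measureReal_nonneg.lt_of_ne' fun hz => ?_
    have hvi : 0 < v i := hτ0.trans_lt hiv
    have hle := fun k (hk : i ≤ k) => hX.le_scThreshold_of_measureReal_eq_zero hm hk hvi hz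
    have hbad : ¬ scThreshold μ (Prophet.prefixThrough X i) < α * v i := fun h => by
      have := hle i le_rfl
      nlinarith
    rcases hcases with ⟨h1, -⟩ | ⟨k, h1, -, h3⟩
    · exact hbad (h1 i)
    · rcases lt_or_ge k i with hk | hk
      · exact hbad (h3 i hk)
      · have := hle k hk
        linarith
  have hpos : ∀ x, τ < x → 0 < cdfLT μ X x := by
    intro x hx
    have hx0 : (0 : ℝ) ∈ Set.Iio x := hτ0.trans_lt hx
    rw [cdfLT, allIn_eq_prod hindep measurableSet_Iio]
    refine Finset.prod_pos fun i _ => ?_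
    rcases lt_or_ge (v i) x with h | h
    · rw [hX.measureReal_preimage_of_mem hx0 h]; exact one_pos
    · rw [hX.measureReal_preimage_of_notMem hx0 (not_lt.2 h)]
      exact hq i (hx.trans_le h)
  -- Here `j` is the last index with value at most `w`. It cannot precede the last good index `k`,
  -- because `v k ≤ s < w`.
  have hTAL : ∀ w j, s < w → v j ≤ w → (∀ i, j < i → w < v i) →
      TAL μ (Prophet.prefixThrough X j) (α * w) < α * w := by
    intro w j hw hjw hj
    refine TAL_lt_of_scThreshold_lt (fun _ => hm _) (fun _ => h0 _) (fun _ => hi _) ?_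
    have hle : α * v j ≤ α * w := by gcongr
    rcases hcases with ⟨h1, -⟩ | ⟨k, h1, h2, h3⟩
    · exact (h1 j).trans_le hle
    · rcases lt_trichotomy k j with hk | rfl | hk
      · exact (h3 j hk).trans_le hle
      · rw [← h1, ← hαs]; gcongr
      · have h4 : v k ≤ s := by rw [hs, le_div_iff₀ hα0, h1]; linarith
        exact absurd (hj k hk) (not_lt.2 (h4.trans hw.le))
  -- factorization of the distribution function beyond a prefix
  have hfac : ∀ (j : Fin n) (U : Set ℝ), MeasurableSet U → (0 : ℝ) ∈ U →
      (∀ i, j < i → v i ∉ U) → allIn μ X U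
        = allIn μ (Prophet.prefixThrough X j) U * ∏ i with j < i, μ.real (X i ⁻¹' {0}) := by
    intro j U hU hz hvU
    rw [allIn_eq_prefixThrough_mul hindep hU j]
    congr 1
    refine Finset.prod_congr rfl fun i hij => ?_
    exact hX.measureReal_preimage_of_notMem hz (hvU i (Finset.mem_filter.1 hij).2)
  have hQ : ∀ (j : Fin n) (w : ℝ), τ ≤ w → (∀ i, j < i → w < v i) →
      0 < ∏ i with j < i, μ.real (X i ⁻¹' {0}) := fun j w hw hj =>
    Finset.prod_pos fun i hij => hq i (hw.trans_lt (hj i (Finset.mem_filter.1 hij).2))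
  have hτs : τ ≤ s := by rw [← hαs]; nlinarith
  -- On `(α w, w]`, `F` is the prefix distribution function times a constant, the probability that
  -- all later variables vanish. The constant cancels in `F(w) J(w)`, so the bound for the prefix
  -- suffices.
  have hJ : ∀ w, s < w → cdfLT μ X w * invInt (cdfLT μ X) (α * w) w ≤ w := by
    intro w hw
    have hw0 : 0 < w := hs0.trans_lt hw
    have hαw : α * w ≤ w := by nlinarith
    have hτw : τ < α * w := by rw [← hαs]; gcongr
    by_cases hne : (Finset.univ.filter fun i => v i ≤ w).Nonempty
    · set j := (Finset.univ.filter fun i => v i ≤ w).max' hne with hj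
      have hjw : v j ≤ w := (Finset.mem_filter.1 (Finset.max'_mem _ hne)).2
      have hjlt : ∀ i, j < i → w < v i := fun i hij => by
        by_contra! hc
        exact hij.not_ge (Finset.le_max' _ _ (by simpa using hc))
      have hQj := hQ j w (hτs.trans hw.le) hjlt
      have hfacj : ∀ x, α * w < x → x ≤ w → cdfLT μ X x
          = cdfLT μ (Prophet.prefixThrough X j) x * ∏ i with j < i, μ.real (X i ⁻¹' {0}) :=
        fun x hx hxw => hfac j _ measurableSet_Iio ((hτ0.trans_lt hτw).trans hx)
          fun i hij => not_lt.2 (hxw.trans (hjlt i hij).le)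
      have hI := invInt_le_of_TAL_lt (fun _ => hm _) (iIndepFun_prefixThrough hindep j)
        (fun _ => h0 _) (fun _ => hi _) (hτ0.trans hτw.le) hαw (hTAL w j hw hjw hjlt)
      have hI0 : 0 ≤ invInt (cdfLT μ (Prophet.prefixThrough X j)) (α * w) w :=
        intervalIntegral.integral_nonneg hαw fun x _ => inv_nonneg.2 (allIn_nonneg _)
      rw [invInt_eq_of_eq_mul hαw hfacj, hfacj w (by nlinarith) le_rfl, mul_assoc,
        mul_inv_cancel_left₀ hQj.ne']
      exact (mul_le_of_le_one_left hI0 (allIn_le_one _)).trans hI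
    · have hlt : ∀ i, w < v i := fun i => by
        by_contra! hc
        exact hne ⟨i, Finset.mem_filter.2 ⟨Finset.mem_univ _, hc⟩⟩
      -- With every value above `w`, `F` does not change between `α w` and `w`, and `F(w) J(w) ≤ (1
      -- - α) w`.
      have heq : cdfLT μ X w = cdfLT μ X (α * w) := by
        rw [cdfLT, cdfLT, allIn_eq_prod hindep measurableSet_Iio,
          allIn_eq_prod hindep measurableSet_Iio]
        refine Finset.prod_congr rfl fun i _ => ?_
        rw [hX.measureReal_preimage_of_notMem (U := Set.Iio w) hw0 (not_lt.2 (hlt i).le),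
          hX.measureReal_preimage_of_notMem (U := Set.Iio (α * w)) (hτ0.trans_lt hτw)
            (not_lt.2 (hαw.trans (hlt i).le))]
      have hp := hpos _ hτw
      have h1 := invInt_le cdfLT_mono hαw hp
      rw [le_div_iff₀ hp] at h1
      rw [heq]
      nlinarith
  have hbal : cdfLT μ X τ = 0 ∨
      s ≤ allIn μ X (Set.Iic s) * invInt (cdfLT μ X) τ s := by
    rcases hτ0.eq_or_lt with hz | hτpos
    · exact Or.inl (cdfLT_eq_zero h0 hz.symm.le)
    obtain ⟨k, h1, h2, h3⟩ : ∃ k, τ = scThreshold μ (Prophet.prefixThrough X k) ∧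
        α * v k ≤ scThreshold μ (Prophet.prefixThrough X k) ∧
        ∀ j, k < j → scThreshold μ (Prophet.prefixThrough X j) < α * v j :=
      hcases.resolve_left fun h => hτpos.ne' h.2
    have hvk : v k ≤ s := by rw [hs, le_div_iff₀ hα0, h1]; linarith
    -- Longer prefixes have larger SC-thresholds, so `τ` is at most that of prefix `i`, which is
    -- below `α * v i`.
    have hklt : ∀ i, k < i → s < v i := fun i hki => by
      have h4 := scThreshold_prefixThrough_mono (μ := μ) hm h0 hi hki.le
      have h5 := h3 i hki
      rw [hs, div_lt_iff₀ hα0]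
      linarith
    have hQk := hQ k s hτs hklt
    refine balance_of_forall_lt hτs (allIn_nonneg _) (allIn_le_one _) fun b hb => ?_
    -- The supremum defining the SC-threshold is approached from the left, above `max b 0` so that
    -- `a > 0` as `TAL_le` requires.
    obtain ⟨a, hba, haT⟩ := exists_le_TAL_of_lt_scThreshold
      (X := Prophet.prefixThrough X k) (μ := μ) (fun _ => h0 _) (h1 ▸ max_lt hb hτpos)
    have ha0 : 0 < a := (le_max_right _ _).trans_lt hba
    have haτ : a ≤ τ := by
      rw [h1]
      exact le_scThreshold (fun _ => hm _) (fun _ => h0 _) (fun _ => hi _) ha0.le haT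
    refine ⟨a, (le_max_left _ _).trans_lt hba, haτ, ?_⟩
    have hfack : ∀ x, a ≤ x → x ≤ s → cdfLT μ X x
        = cdfLT μ (Prophet.prefixThrough X k) x * ∏ i with k < i, μ.real (X i ⁻¹' {0}) :=
      fun x hx hxs => hfac k _ measurableSet_Iio (ha0.trans_le hx)
        fun i hij => not_lt.2 (hxs.trans (hklt i hij).le)
    have has : a ≤ s := haτ.trans hτs
    rcases (allIn_nonneg (μ := μ) (X := Prophet.prefixThrough X k) (Set.Iio a)).eq_or_lt
      with hz | hz
    · left
      rw [hfack a le_rfl has, cdfLT, ← hz, zero_mul]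
    right
    have hvi : ∀ i : Fin (k.val + 1), v (Fin.castLE k.isLt i) ≤ s := fun i =>
      (hX.sorted (Fin.le_def.2 (Nat.lt_succ_iff.1 i.2))).trans hvk
    have hup := (hX.prefixThrough k).TAL_le (fun _ => hm _) (iIndepFun_prefixThrough hindep k)
      ha0 has hvi hz
    have hG : allIn μ (Prophet.prefixThrough X k) (Set.Iic s) = 1 := by
      rw [allIn_eq_prod (iIndepFun_prefixThrough hindep k) measurableSet_Iic]
      exact Finset.prod_eq_one fun i _ =>
        (hX.prefixThrough k).measureReal_preimage_of_mem (U := Set.Iic s) hs0 (hvi i)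
    -- `P(M ≤ s)` is exactly the factor relating `F` to the prefix distribution function on `[a,
    -- s]`, so balance reduces to `s ≤ ∫ 1 / F` for the prefix; its failure would contradict `a ≤
    -- TAL` through `TAL_le`.
    rw [hfac k _ measurableSet_Iic hs0 fun i hki => not_le.2 (hklt i hki), hG, one_mul,
      invInt_eq_of_eq_mul has fun x hx hxs => hfack x hx.le hxs, mul_inv_cancel_left₀ hQk.ne']
    by_contra! hc
    have := mul_pos hz (sub_pos.2 hc)
    unfold cdfLT at *
    linarith
  have := OPT_le_augTAL hα0 hα1 hm hindep h0 hi hs0 (by rwa [hαs]) hJ (by rwa [hαs])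
  rwa [hαs] at this

end Bernoulli

end Prophet

end

theorem theorem3p1 (α : ℝ) (hα0 : 0 < α) (hα1 : α < 1)
    {Ω : Type*} [MeasurableSpace Ω] (μ : Measure Ω) [IsProbabilityMeasure μ]
    {n : ℕ} (X : Fin n → Ω → ℝ) (hmeas : ∀ i, Measurable (X i)) (hindep : iIndepFun X μ) :
    -- general instances: some base threshold achieves the ratio `1 / (2 - α)`
    ((∀ i, ∀ᵐ ω ∂μ, 0 ≤ X i ω) → (∀ i, Integrable (X i) μ) →
      ∃ τ : ℝ, 0 ≤ τ ∧ 1 / (2 - α) * Prophet.OPT μ X ≤ Prophet.augTAL μ α X τ) ∧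
    -- sorted scaled Bernoulli instances: the explicit base threshold achieves it
    (∀ v : Fin n → ℝ, Prophet.IsSortedScaledBernoulli μ X v →
      0 ≤ Prophet.tauStar μ α X v ∧
      1 / (2 - α) * Prophet.OPT μ X ≤
        Prophet.augTAL μ α X (Prophet.tauStar μ α X v)) :=
  ⟨fun h0 hi => Prophet.exists_OPT_le_augTAL hα0 hα1 hmeas hindep h0 hi, fun _ hX =>
    ⟨Prophet.tauStar_nonneg α, hX.OPT_le_augTAL_tauStar hα0 hα1 hmeas hindep⟩⟩
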